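/- All graphs are finite and simple. The girth of a graph is the length of a shortest cycle ($+\infty$ for a forest). For a graph $G=(V,E)$ fix any linear ordering of $E$. A broken circuit of $G$ is the edge set of a cycle of $G$ with its largest edge removed; a set $F\subseteq E$ is broken-circuit-free (BCF) if it contains no broken circuit. Let $F_G(x)=\sum_{F\subseteq E\text{ BCF}}x^{|F|}$, and let $\chi_G(x)=\sum_{A\subseteq E}(-1)^{|A|}x^{\kappa(A)}$ be the chromatic polynomial of $G$, where $\kappa(A)$ is the number of components of $(V,A)$. **Theorem.** Let $g\ge 3$ be an integer. For $a\in[0,1)$ and $b\in[1,e)$ put $$h(a,b)=\frac{(1-a)\ln b}{b},\qquad f_g(a,b)=\exp\left(\frac{(1-a)\ln b}{b}\right)-1+\frac{b\,(\ln b)^{g-1}}{2(1-\ln b)}.$$ Suppose that $a\in[0,1)$ and $b\in[1,e)$ satisfy $f_g(a,b)\le a$. Let $\Delta\ge 1$ be an integer and let $G$ be a graph of girth at least $g$ and maximum degree at most $\Delta$. Then, for every ordering of $E$, $F_G(x)\ne 0$ for all $x\in\mathbb{C}$ with $|x|\le h(a,b)/\Delta$. Moreover, if $h(a,b)>0$ (that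 is, if $b>1$), then $\chi_G(x)\neq 0$ for all $x\in\mathbb{C}$ with $|x|\ge \Delta/h(a,b)$. -/

import Mathlib

open Polynomial

namespace ChromaticZeros

universe u

variable {V : Type u}

/-- `B` is a broken circuit of `G`, with respect to a linear order `ord` on the edges of `G`:
the edge set of some cycle of `G` with the largest edge `m` of that cycle removed.
(`ord.le` is written out because `≤` would find the inclusion order that `Sym2 V` carries.) -/
def IsBrokenCircuit (G : SimpleGraph V) (ord : LinearOrder G.edgeSet) (B : Set (Sym2 V)) : Prop :=
  ∃ (v : V) (c : G.Walk v v) (m : G.edgeSet), c.IsCycle ∧ (m : Sym2 V) ∈ c.edgeSet ∧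
    (∀ e : G.edgeSet, (e : Sym2 V) ∈ c.edgeSet → ord.le e m) ∧ B = c.edgeSet \ {(m : Sym2 V)}

/-- `F` is a broken-circuit-free set of `G`: a set of edges containing no broken circuit. -/
def IsBCF (G : SimpleGraph V) (ord : LinearOrder G.edgeSet) (F : Set (Sym2 V)) : Prop :=
  F ⊆ G.edgeSet ∧ ∀ B : Set (Sym2 V), IsBrokenCircuit G ord B → ¬ B ⊆ F

open Classical in
/-- The generating function `F_G(x) = ∑ x ^ |F|`, summed over the broken-circuit-free sets `F`
of `G` (with respect to the order `ord` on the edges). -/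
noncomputable def bcfPoly [Fintype V] (G : SimpleGraph V) [DecidableRel G.Adj]
    (ord : LinearOrder G.edgeSet) : ℂ[X] :=
  ∑ F ∈ G.edgeFinset.powerset.filter (fun F : Finset (Sym2 V) => IsBCF G ord (F : Set (Sym2 V))),
    X ^ F.card

/-- `κ(A)`: the number of connected components of the graph `(V, A)`. -/
noncomputable def numComponents (A : Set (Sym2 V)) : ℕ :=
  Nat.card (SimpleGraph.fromEdgeSet A).ConnectedComponent

/-- The chromatic polynomial `χ_G(x) = ∑_{A ⊆ E} (-1) ^ |A| x ^ κ(A)`. -/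
noncomputable def chromaticPoly [Fintype V] (G : SimpleGraph V) [DecidableRel G.Adj] : ℂ[X] :=
  ∑ A ∈ G.edgeFinset.powerset, (-1) ^ A.card * X ^ numComponents (A : Set (Sym2 V))

/-- `h(a, b) = (1 - a) ln b / b`. -/
noncomputable def hFun (a b : ℝ) : ℝ := (1 - a) * Real.log b / b

/-- `f_g(a, b) = exp ((1 - a) ln b / b) - 1 + b (ln b) ^ (g - 1) / (2 (1 - ln b))`. -/
noncomputable def fFun (g : ℕ) (a b : ℝ) : ℝ :=
  Real.exp ((1 - a) * Real.log b / b) - 1 +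
    b * Real.log b ^ (g - 1) / (2 * (1 - Real.log b))

end ChromaticZeros

/-! Work with functions of finite vertex sets under disjoint-union convolution, with exponential
`setExp` (sum over partitions into blocks). If φ is the logarithm of the indicator of independent
sets, then χ_G(z) is the exponential of zφ (`eval_chromaticPoly`): a q-coloring is an ordered
partition into q independent classes. Whitney's theorem and the substitution z = -1/x turn this into
F_G(x) = Z(V), where Z(U) is the exponential of x^(|B|-1) t(B) and t = ±φ (`eval_bcfPoly`,
`partFun_univ`). Combinatorially t(B) counts the broken-circuit-free spanning trees of G[B], but the
proof uses only t ≥ 0 and a recursion: deleting u from a block leaves blocks that each meet N(u)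
(`blockCoeff_insert`).

For Z the recursion says that adding u to U multiplies each block meeting N(u) by 1 + x
(`partFun_insert`). If no block met N(u) twice, Z(U ∪ {u}) would be (1 + x)^d Z(U), with d the
number of neighbours in U. The error comes from blocks joining two neighbours of u, and by the girth
such neighbours are at distance at least g - 2 without u. With positive weights y^|B| t(B), the
blocks joining a vertex to a set at distance m have total weight at most a geometric tail
(`sum_blockSum_le`), and this controls the error (`norm_attachDefect_le`).

The induction maintains (1 - a)|Z(U)| ≤ |Z(U ∪ {u})|. Deleting a block B then costs at most (1 -
a)^(-|B|), which |x| ≤ (1 - a)y absorbs. The relative change of Z on adding u is bounded by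
f_g(a,b): its exponential part bounds |(1 + x)^d - 1|, its other part the error. Hence f_g(a,b) ≤ a
closes the induction (`partFun_step`, `partFun_ratio`), and Z never vanishes. -/

namespace ChromaticZeros

/-! ### Convolution and exponential of set functions -/

section SetExp

variable {V : Type*} [DecidableEq V] {R : Type*} [CommRing R]

/-- Convolution of set functions: `∑ f B * g (U \ B)` over the subsets `B` of `U`. -/
def conv (f g : Finset V → R) (U : Finset V) : R :=
  ∑ B ∈ U.powerset, f B * g (U \ B)

/-- The restriction of a set function to the sets that contain `v`. -/
def restrictAt (v : V) (f : Finset V → R) (B : Finset V) : R := if v ∈ B then f B else 0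

theorem conv_comm (f g : Finset V → R) : conv f g = conv g f := by
  funext U
  unfold conv
  refine Finset.sum_bij' (fun B _ => U \ B) (fun B _ => U \ B) ?_ ?_ ?_ ?_ ?_
  · intro B _; simp
  · intro B _; simp
  · intro B hB; simpa using hB
  · intro B hB; simpa using hB
  · intro B hB
    have : U \ (U \ B) = B := by simpa using hB
    rw [this, mul_comm]

theorem conv_assoc (f g h : Finset V → R) : conv (conv f g) h = conv f (conv g h) := by
  funext U
  unfold conv
  simp only [Finset.sum_mul, Finset.mul_sum]
  rw [Finset.sum_sigma', Finset.sum_sigma']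
  refine Finset.sum_bij' (fun p _ => ⟨p.2, p.1 \ p.2⟩) (fun p _ => ⟨p.1 ∪ p.2, p.1⟩) ?_ ?_ ?_ ?_ ?_
  · rintro ⟨B, C⟩ hp
    simp only [Finset.mem_sigma, Finset.mem_powerset] at hp ⊢
    exact ⟨hp.2.trans hp.1, Finset.sdiff_subset_sdiff hp.1 le_rfl⟩
  · rintro ⟨B, C⟩ hp
    simp only [Finset.mem_sigma, Finset.mem_powerset] at hp ⊢
    exact ⟨Finset.union_subset hp.1 (hp.2.trans Finset.sdiff_subset), Finset.subset_union_left⟩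
  · rintro ⟨B, C⟩ hp
    simp only [Finset.mem_sigma, Finset.mem_powerset] at hp
    simp [Finset.union_eq_right.mpr hp.2]
  · rintro ⟨B, C⟩ hp
    simp only [Finset.mem_sigma, Finset.mem_powerset] at hp
    have : Disjoint B C := by
      rw [Finset.disjoint_right]
      intro a ha
      exact (Finset.mem_sdiff.mp (hp.2 ha)).2
    simp [Finset.union_sdiff_cancel_left this]
  · rintro ⟨B, C⟩ hp
    simp only [Finset.mem_sigma, Finset.mem_powerset] at hp
    have : (U \ C) \ (B \ C) = U \ B := by
      ext a
      have := @hp.2 a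
      simp only [Finset.mem_sdiff]
      tauto
    simp only [this, mul_assoc]

theorem conv_add_left (f g h : Finset V → R) (U : Finset V) :
    conv (f + g) h U = conv f h U + conv g h U := by
  simp [conv, add_mul, Finset.sum_add_distrib]

theorem conv_congr {f f' g g' : Finset V → R} {U : Finset V}
    (h : ∀ B ⊆ U, f B * g (U \ B) = f' B * g' (U \ B)) : conv f g U = conv f' g' U :=
  Finset.sum_congr rfl fun B hB => h B (Finset.mem_powerset.mp hB)

/-- The exponential of a set function: the sum over all partitions of `U` of the product of the
values at the blocks, computed by expanding along the block of a chosen element. -/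
noncomputable def setExp (f : Finset V → R) (U : Finset V) : R :=
  open Classical in
  if h : U.Nonempty then
    ∑ B ∈ U.powerset.attach, if _hB : h.choose ∈ B.1 then f B.1 * setExp f (U \ B.1) else 0
  else 1
termination_by U.card
decreasing_by
  exact Finset.card_lt_card (Finset.sdiff_ssubset (Finset.mem_powerset.mp B.2) ⟨_, _hB⟩)

@[simp] theorem setExp_empty (f : Finset V → R) : setExp f ∅ = 1 := by
  rw [setExp]; simp

theorem setExp_choose (f : Finset V → R) {U : Finset V} (h : U.Nonempty) :
    setExp f U = conv (restrictAt h.choose f) (setExp f) U := by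
  rw [setExp]
  simp only [h, dite_true]
  rw [Finset.sum_attach U.powerset
    (fun B => if hB : h.choose ∈ B then f B * setExp f (U \ B) else 0)]
  refine Finset.sum_congr rfl fun B _ => ?_
  unfold restrictAt
  split_ifs <;> simp

theorem conv_restrictAt_of_notMem (v : V) (f g : Finset V → R) {U : Finset V} (h : v ∉ U) :
    conv (restrictAt v f) g U = 0 := by
  refine Finset.sum_eq_zero fun B hB => ?_
  have : v ∉ B := fun hv => h (Finset.mem_powerset.mp hB hv)
  simp [restrictAt, this]

/-- The exponential can be expanded along the block of any element. -/
theorem setExp_expand (f : Finset V → R) {U : Finset V} {v : V} (hv : v ∈ U) :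
    setExp f U = conv (restrictAt v f) (setExp f) U := by
  induction hn : U.card using Nat.strong_induction_on generalizing U v with
  | _ n ih =>
  have hne : U.Nonempty := ⟨v, hv⟩
  rw [setExp_choose f hne]
  have hp := hne.choose_spec
  generalize hne.choose = p at hp
  -- Expanding along `a`, and then along `b` when `b` lies outside the block of `a`, gives an
  -- expression symmetric in `a` and `b`; hence the choice of element is immaterial.
  have key : ∀ a b : V, a ∈ U → b ∈ U → conv (restrictAt a f) (setExp f) U =
      conv (restrictAt a (restrictAt b f)) (setExp f) U +
        conv (conv (fun B => if b ∈ B then 0 else restrictAt a f B)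
          (fun B => if a ∈ B then 0 else restrictAt b f B)) (setExp f) U := by
    intro a b ha hb
    rw [conv_assoc]
    unfold conv
    rw [← Finset.sum_add_distrib]
    refine Finset.sum_congr rfl fun B hB => ?_
    by_cases haB : a ∈ B
    · by_cases hbB : b ∈ B
      · simp [restrictAt, haB, hbB]
      · have hlt : (U \ B).card < n := hn ▸
          Finset.card_lt_card (Finset.sdiff_ssubset (Finset.mem_powerset.mp hB) ⟨_, haB⟩)
        have := ih _ hlt (U := U \ B) (v := b) (by simp [hb, hbB]) rfl
        simp only [restrictAt, haB, hbB, if_true, if_false, zero_mul, zero_add, ite_self]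
        rw [this]
        congr 1
        refine Finset.sum_congr rfl fun C hC => ?_
        have : a ∉ C := fun h => (Finset.mem_sdiff.mp (Finset.mem_powerset.mp hC h)).2 haB
        simp [restrictAt, this]
    · simp [restrictAt, haB]
  rw [key p v hp hv, key v p hv hp]
  congr 1
  · congr 1
    funext B
    unfold restrictAt
    split_ifs <;> rfl
  · rw [conv_comm (fun B => if v ∈ B then 0 else restrictAt p f B)]

/-- Induction on the set: the block of `v` is nonempty, so the recursion only calls smaller sets.
The element may depend on `W`, which makes this the standard tool for identifying an exponential. -/
theorem setExp_unique (f : Finset V → R) {U : Finset V} (Ψ : Finset V → R) (h0 : Ψ ∅ = 1)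
    (h : ∀ W ⊆ U, W.Nonempty → ∃ v ∈ W, Ψ W = conv (restrictAt v f) Ψ W) : Ψ U = setExp f U := by
  induction hn : U.card using Nat.strong_induction_on generalizing U with
  | _ n ih =>
  rcases U.eq_empty_or_nonempty with rfl | hU
  · simp [h0]
  · obtain ⟨v, hv, hΨ⟩ := h U le_rfl hU
    rw [hΨ, setExp_expand f hv]
    refine conv_congr fun B hB => ?_
    by_cases hvB : v ∈ B
    · rw [ih (U \ B).card (hn ▸ Finset.card_lt_card (Finset.sdiff_ssubset hB ⟨_, hvB⟩))
        (fun W hW => h W (hW.trans Finset.sdiff_subset)) rfl]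
    · simp [restrictAt, hvB]

theorem setExp_congr {f g : Finset V → R} {U : Finset V}
    (h : ∀ B ⊆ U, B.Nonempty → f B = g B) : setExp f U = setExp g U := by
  refine setExp_unique g _ (setExp_empty f) fun W hW ⟨v, hv⟩ => ⟨v, hv, ?_⟩
  rw [setExp_expand f hv]
  refine conv_congr fun B hB => ?_
  by_cases hvB : v ∈ B
  · simp [restrictAt, hvB, h B (hB.trans hW) ⟨v, hvB⟩]
  · simp [restrictAt, hvB]

theorem conv_setExp_expand (f g : Finset V → R) {U : Finset V} {v : V} (hv : v ∈ U) :
    conv (setExp f) (setExp g) U =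
      conv (conv (restrictAt v f) (setExp f)) (setExp g) U +
        conv (setExp f) (conv (restrictAt v g) (setExp g)) U := by
  unfold conv
  rw [← Finset.sum_add_distrib]
  refine Finset.sum_congr rfl fun B hB => ?_
  change _ = conv _ _ B * _ + _ * conv _ _ (U \ B)
  by_cases hvB : v ∈ B
  · rw [← setExp_expand f hvB, conv_restrictAt_of_notMem v g (U := U \ B) _ (by simp [hvB])]
    simp
  · rw [conv_restrictAt_of_notMem v f _ hvB, ← setExp_expand g (U := U \ B) (by simp [hv, hvB])]
    simp

theorem setExp_add (f g : Finset V → R) (U : Finset V) :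
    setExp (f + g) U = conv (setExp f) (setExp g) U := by
  symm
  refine setExp_unique (f + g) _ (by simp [conv]) fun W _ ⟨v, hv⟩ => ⟨v, hv, ?_⟩
  rw [conv_setExp_expand f g hv, conv_assoc, conv_comm (setExp f) (conv _ _), conv_assoc,
    conv_comm (setExp g) (setExp f)]
  have : restrictAt v (f + g) = restrictAt v f + restrictAt v g := by
    funext B
    by_cases h : v ∈ B <;> simp [restrictAt, h]
  rw [this, conv_add_left]

/-- The restriction of a set function to the sets that meet `N`. -/
def meeting (N : Finset V) (f : Finset V → R) (B : Finset V) : R :=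
  if Disjoint B N then 0 else f B

/-- The restriction of a set function to the sets that avoid `N`. -/
def avoiding (N : Finset V) (f : Finset V → R) (B : Finset V) : R :=
  if Disjoint B N then f B else 0

/-- A point of `W` in `N` makes one factor of every partition of `W` vanish; without such a point
nothing changes. -/
theorem setExp_avoiding (N : Finset V) (f : Finset V → R) (U : Finset V) :
    setExp (avoiding N f) U = avoiding N (setExp f) U := by
  symm
  refine setExp_unique _ _ (by simp [avoiding]) fun W _ hW => ?_
  by_cases hd : Disjoint W N
  · obtain ⟨v, hv⟩ := hW
    refine ⟨v, hv, ?_⟩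
    simp only [avoiding, hd, if_true]
    rw [setExp_expand f hv]
    refine conv_congr fun B hB => ?_
    have h1 : Disjoint B N := hd.mono_left hB
    have h2 : Disjoint (W \ B) N := hd.mono_left Finset.sdiff_subset
    simp [restrictAt, avoiding, h1, h2]
  · obtain ⟨v, hv, hvN⟩ := Finset.not_disjoint_iff.mp hd
    refine ⟨v, hv, ?_⟩
    rw [avoiding, if_neg hd]
    refine (Finset.sum_eq_zero fun B hB => ?_).symm
    by_cases hvB : v ∈ B
    · have : ¬ Disjoint B N := Finset.not_disjoint_iff.mpr ⟨v, hvB, hvN⟩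
      simp [restrictAt, avoiding, this]
    · simp [restrictAt, hvB]

theorem setExp_pow_card_mul (c : R) (f : Finset V → R) (U : Finset V) :
    setExp (fun B => c ^ B.card * f B) U = c ^ U.card * setExp f U := by
  symm
  refine setExp_unique _ (fun U => c ^ U.card * setExp f U) (by simp) fun W _ ⟨v, hv⟩ =>
    ⟨v, hv, ?_⟩
  rw [setExp_expand f hv]
  unfold conv
  rw [Finset.mul_sum]
  refine Finset.sum_congr rfl fun B hB => ?_
  have : c ^ W.card = c ^ B.card * c ^ (W \ B).card := by
    rw [← pow_add, add_comm, Finset.card_sdiff_add_card_eq_card (Finset.mem_powerset.mp hB)]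
  rw [this]
  unfold restrictAt
  split_ifs <;> ring

theorem map_setExp {S : Type*} [CommRing S] (σ : R →+* S) (f : Finset V → R) (U : Finset V) :
    σ (setExp f U) = setExp (fun B => σ (f B)) U := by
  refine setExp_unique _ (fun U => σ (setExp f U)) (by simp) fun W _ ⟨v, hv⟩ => ⟨v, hv, ?_⟩
  rw [setExp_expand f hv]
  simp only [conv, restrictAt, map_sum, map_mul, apply_ite σ, map_zero]

/-- A set function with value 1 at `∅` is invertible for convolution: the term `B = U` isolates the
value at `U`, and the others agree by induction. -/
theorem conv_left_cancel {f g h : Finset V → R} (h0 : h ∅ = 1) (U : Finset V)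
    (hfg : ∀ W ⊆ U, conv f h W = conv g h W) : f U = g U := by
  induction hn : U.card using Nat.strong_induction_on generalizing U with
  | _ n ih =>
  have h1 := hfg U le_rfl
  unfold conv at h1
  rw [← Finset.sum_erase_add _ _ (Finset.mem_powerset_self U),
    ← Finset.sum_erase_add _ _ (Finset.mem_powerset_self U)] at h1
  have h2 : ∑ B ∈ U.powerset.erase U, f B * h (U \ B) =
      ∑ B ∈ U.powerset.erase U, g B * h (U \ B) := by
    refine Finset.sum_congr rfl fun B hB => ?_
    obtain ⟨hne, hB⟩ := Finset.mem_erase.mp hB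
    have hB := Finset.mem_powerset.mp hB
    rw [ih B.card (hn ▸ Finset.card_lt_card (hB.ssubset_of_ne hne)) B
      (fun W hW => hfg W (hW.trans hB)) rfl]
  rw [h2] at h1
  simpa [h0] using add_left_cancel h1

end SetExp

section Nonneg

variable {V : Type*} [DecidableEq V]

theorem setExp_nonneg {R : Type*} [CommRing R] [PartialOrder R] [IsOrderedRing R]
    {f : Finset V → R} {U : Finset V} (h : ∀ B ⊆ U, B.Nonempty → 0 ≤ f B) : 0 ≤ setExp f U := by
  induction hn : U.card using Nat.strong_induction_on generalizing U with
  | _ n ih =>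
  rcases U.eq_empty_or_nonempty with rfl | ⟨v, hv⟩
  · simp
  · rw [setExp_expand f hv]
    refine Finset.sum_nonneg fun B hB => ?_
    have hB := Finset.mem_powerset.mp hB
    by_cases hvB : v ∈ B
    · simp only [restrictAt, hvB, if_true]
      exact mul_nonneg (h B hB ⟨v, hvB⟩)
        (ih _ (hn ▸ Finset.card_lt_card (Finset.sdiff_ssubset hB ⟨_, hvB⟩))
          (fun W hW => h W (hW.trans Finset.sdiff_subset)) rfl)
    · simp [restrictAt, hvB]

end Nonneg

/-! ### Logarithm of a set function -/

section SetLog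

variable {V : Type*} [DecidableEq V] {R : Type*} [CommRing R]

/-- The logarithm of a set function, the inverse of `setExp`. -/
noncomputable def setLog (g : Finset V → R) (U : Finset V) : R :=
  open Classical in
  if h : U.Nonempty then
    g U - ∑ B ∈ U.powerset.attach,
      if _hB : h.choose ∈ B.1 ∧ B.1 ≠ U then setLog g B.1 * g (U \ B.1) else 0
  else 0
termination_by U.card
decreasing_by
  exact Finset.card_lt_card ((Finset.mem_powerset.mp B.2).ssubset_of_ne _hB.2)

theorem setExp_setLog {g : Finset V → R} (h0 : g ∅ = 1) : setExp (setLog g) = g := by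
  funext U
  symm
  refine setExp_unique _ g h0 fun W _ hW => ⟨hW.choose, hW.choose_spec, ?_⟩
  have hspec := hW.choose_spec
  have hlog : setLog g W = g W - ∑ B ∈ W.powerset.erase W,
      restrictAt hW.choose (setLog g) B * g (W \ B) := by
    rw [setLog]
    simp only [hW, dite_true]
    rw [Finset.sum_attach W.powerset
      (fun B => if _hB : hW.choose ∈ B ∧ B ≠ W then setLog g B * g (W \ B) else 0)]
    congr 1
    rw [← Finset.sum_erase_add _ _ (Finset.mem_powerset_self W)]
    simp only [ne_eq, not_true_eq_false, and_false, dite_false, add_zero]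
    refine Finset.sum_congr rfl fun B hB => ?_
    have := (Finset.mem_erase.mp hB).1
    unfold restrictAt
    by_cases h : hW.choose ∈ B <;> simp [h, this]
  unfold conv
  rw [← Finset.sum_erase_add _ _ (Finset.mem_powerset_self W)]
  rw [show restrictAt hW.choose (setLog g) W = setLog g W from if_pos hspec, Finset.sdiff_self, h0, hlog]
  ring

end SetLog

/-! ### Block coefficients: recursion and positivity -/

section Ursell

variable {V : Type*} [DecidableEq V] (G : SimpleGraph V)

open Classical in
/-- The indicator function of the independent sets of `G`. -/
noncomputable def indepInd (U : Finset V) : ℤ := if G.IsIndepSet (U : Set V) then 1 else 0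

@[simp] theorem indepInd_empty : indepInd G ∅ = 1 := by
  simp [indepInd, SimpleGraph.IsIndepSet]

/-- The coefficient of the block `B`: up to sign, the logarithm of the indicator function of the
independent sets. -/
noncomputable def blockCoeff (B : Finset V) : ℤ := (-1) ^ (B.card + 1) * setLog (indepInd G) B

theorem setLog_indepInd (B : Finset V) :
    setLog (indepInd G) B = (-1) ^ (B.card + 1) * blockCoeff G B := by
  rw [blockCoeff, ← mul_assoc, ← mul_pow]
  simp

theorem indepInd_insert [Fintype V] [DecidableRel G.Adj] (u : V) (B : Finset V) :
    indepInd G (insert u B) = avoiding (G.neighborFinset u) (indepInd G) B := by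
  unfold avoiding indepInd
  rw [← ite_and]
  congr 1
  have hd : Disjoint B (G.neighborFinset u) ↔ ∀ w ∈ B, ¬ G.Adj u w := by
    simp [Finset.disjoint_left]
  rw [hd]
  simp only [SimpleGraph.IsIndepSet, Finset.coe_insert, Set.pairwise_insert, Finset.mem_coe,
    eq_iff_iff]
  constructor
  · rintro ⟨h1, h2⟩
    refine ⟨fun w hw hadj => ?_, h1⟩
    exact (h2 w hw hadj.ne).1 hadj
  · rintro ⟨h1, h2⟩
    exact ⟨h2, fun w hw _ => ⟨h1 w hw, fun h => h1 w hw h.symm⟩⟩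

/-- This is the logarithmic derivative at `u`. With φ the logarithm, the exponential of φ at `insert
u W` is the convolution of φ(u ∪ ·) with exp φ. It is also exp φ restricted to sets avoiding the
neighbours of `u`, that is exp(-φ on sets meeting them) convolved with exp φ. Cancel exp φ. -/
theorem setLog_indepInd_insert [Fintype V] [DecidableRel G.Adj] {u : V} {B : Finset V}
    (hu : u ∉ B) :
    setLog (indepInd G) (insert u B) =
      setExp (-meeting (G.neighborFinset u) (setLog (indepInd G))) B := by
  set φ := setLog (indepInd G) with hφ
  set N := G.neighborFinset u
  have hexp : setExp φ = indepInd G := setExp_setLog (indepInd_empty G)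
  refine conv_left_cancel (f := fun B => φ (insert u B)) (h := setExp φ) (setExp_empty φ) B
    fun W hW => ?_
  have huW : u ∉ W := fun h => hu (hW h)
  rw [← setExp_add]
  have h1 : -meeting N φ + φ = avoiding N φ := by
    funext C
    simp only [Pi.add_apply, Pi.neg_apply, meeting, avoiding]
    split_ifs <;> simp
  rw [h1, setExp_avoiding, hexp, ← indepInd_insert, ← hexp,
    setExp_expand φ (Finset.mem_insert_self u W)]
  unfold conv
  rw [Finset.sum_powerset_insert huW]
  have h2 : ∑ C ∈ W.powerset, restrictAt u φ C * setExp φ (insert u W \ C) = 0 :=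
    Finset.sum_eq_zero fun C hC => by
      have : u ∉ C := fun h => huW (Finset.mem_powerset.mp hC h)
      simp [restrictAt, this]
  rw [h2, zero_add]
  refine Finset.sum_congr rfl fun C hC => ?_
  have : insert u W \ insert u C = W \ C := by
    ext a
    simp only [Finset.mem_sdiff, Finset.mem_insert]
    constructor
    · tauto
    · rintro ⟨h, h'⟩
      exact ⟨Or.inr h, by rintro (rfl | h'') <;> tauto⟩
  simp [restrictAt, this]

theorem blockCoeff_insert [Fintype V] [DecidableRel G.Adj] {u : V} {B : Finset V} (hu : u ∉ B) :
    blockCoeff G (insert u B) = setExp (meeting (G.neighborFinset u) (blockCoeff G)) B := by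
  rw [blockCoeff, setLog_indepInd_insert G hu, Finset.card_insert_of_notMem hu]
  have : (-1 : ℤ) ^ (B.card + 1 + 1) = (-1) ^ B.card := by ring
  rw [this, ← setExp_pow_card_mul]
  congr 1
  funext C
  simp only [Pi.neg_apply, meeting, blockCoeff]
  split_ifs
  · simp
  · ring

/-- The sign in `blockCoeff` makes the recursion `blockCoeff_insert` free of signs, so positivity
propagates from smaller blocks. -/
theorem blockCoeff_nonneg [Fintype V] {B : Finset V} (hB : B.Nonempty) : 0 ≤ blockCoeff G B := by
  classical
  induction hn : B.card using Nat.strong_induction_on generalizing B with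
  | _ n ih =>
  obtain ⟨u, hu⟩ := hB
  rw [← Finset.insert_erase hu, blockCoeff_insert G (Finset.notMem_erase u B)]
  refine setExp_nonneg fun C hC hne => ?_
  unfold meeting
  split_ifs
  · rfl
  · exact ih C.card (hn ▸ (Finset.card_le_card hC).trans_lt (Finset.card_erase_lt_of_mem hu)) hne rfl

end Ursell

/-! ### Sums over families of disjoint blocks -/

section SubsetSum

variable {V : Type*} [DecidableEq V]

/-- The sum of `setExp h` over all subsets of `U`. -/
noncomputable def subsetExp (h : Finset V → ℝ) (U : Finset V) : ℝ := ∑ W ∈ U.powerset, setExp h W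

/-- The sum of `f` over the subsets of `U` that contain both `s` and `w`. -/
def blockSum (f : Finset V → ℝ) (U : Finset V) (s w : V) : ℝ :=
  ∑ B ∈ U.powerset, if s ∈ B ∧ w ∈ B then f B else 0

theorem subsetExp_eq_conv (h : Finset V → ℝ) : subsetExp h = conv (setExp h) 1 := by
  funext U
  simp [subsetExp, conv]

theorem sum_mem_setExp (h : Finset V → ℝ) (U : Finset V) (v : V) :
    ∑ W ∈ U.powerset, (if v ∈ W then setExp h W else 0) = conv (restrictAt v h) (subsetExp h) U := by
  rw [subsetExp_eq_conv, ← conv_assoc]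
  refine Finset.sum_congr rfl fun W _ => ?_
  by_cases hv : v ∈ W
  · simp [hv, ← setExp_expand h hv]
  · simp [hv, conv_restrictAt_of_notMem v h (setExp h) hv]

theorem sum_powerset_split {M : Type*} [AddCommMonoid M] (F : Finset V → M) {U : Finset V} {v : V}
    (hv : v ∈ U) : ∑ W ∈ U.powerset, F W =
      ∑ W ∈ (U.erase v).powerset, F W + ∑ W ∈ (U.erase v).powerset, F (insert v W) := by
  conv_lhs => rw [← Finset.insert_erase hv]
  exact Finset.sum_powerset_insert (Finset.notMem_erase v U) F

theorem subsetExp_expand (h : Finset V → ℝ) {U : Finset V} {v : V} (hv : v ∈ U) :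
    subsetExp h U = subsetExp h (U.erase v) + conv (restrictAt v h) (subsetExp h) U := by
  rw [← sum_mem_setExp, sum_powerset_split _ hv, subsetExp, sum_powerset_split _ hv, subsetExp]
  have : ∑ W ∈ (U.erase v).powerset, (if v ∈ W then setExp h W else 0) = 0 :=
    Finset.sum_eq_zero fun W hW => by
      have : v ∉ W := fun h => Finset.notMem_erase v U (Finset.mem_powerset.mp hW h)
      simp [this]
  simp [this]

theorem subsetExp_congr {f g : Finset V → ℝ} {U : Finset V}
    (h : ∀ B ⊆ U, B.Nonempty → f B = g B) : subsetExp f U = subsetExp g U :=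
  Finset.sum_congr rfl fun _ hW =>
    setExp_congr fun B hB => h B (hB.trans (Finset.mem_powerset.mp hW))

theorem meeting_insert_of_notMem {R : Type*} [CommRing R] (N : Finset V) (f : Finset V → R) {v : V}
    {B : Finset V} (hv : v ∉ B) : meeting (insert v N) f B = meeting N f B := by
  simp [meeting, hv]

theorem blockSum_of_notMem_right (f : Finset V → ℝ) {U : Finset V} {s w : V} (h : w ∉ U) :
    blockSum f U s w = 0 :=
  Finset.sum_eq_zero fun B hB => by
    have : w ∉ B := fun hw => h (Finset.mem_powerset.mp hB hw)
    simp [this]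

theorem blockSum_comm (f : Finset V → ℝ) (U : Finset V) (s w : V) :
    blockSum f U s w = blockSum f U w s := by
  simp only [blockSum, and_comm]

theorem blockSum_of_notMem_left (f : Finset V → ℝ) {U : Finset V} {s w : V} (h : s ∉ U) :
    blockSum f U s w = 0 := by
  rw [blockSum_comm, blockSum_of_notMem_right f h]

variable {f : Finset V → ℝ}

theorem blockSum_nonneg (hf : ∀ B : Finset V, B.Nonempty → 0 ≤ f B) (U : Finset V) (s w : V) :
    0 ≤ blockSum f U s w :=
  Finset.sum_nonneg fun B _ => by
    split_ifs with h
    · exact hf B ⟨_, h.1⟩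
    · rfl

theorem blockSum_mono (hf : ∀ B : Finset V, B.Nonempty → 0 ≤ f B) {U W : Finset V} (h : U ⊆ W)
    (s w : V) : blockSum f U s w ≤ blockSum f W s w :=
  Finset.sum_le_sum_of_subset_of_nonneg (Finset.powerset_mono.mpr h) fun B _ _ => by
    split_ifs with h
    · exact hf B ⟨_, h.1⟩
    · rfl

theorem sum_meeting_le (hf : ∀ B : Finset V, B.Nonempty → 0 ≤ f B) (U N : Finset V) (v : V) :
    ∑ B ∈ U.powerset, restrictAt v (meeting N f) B ≤ ∑ w ∈ N, blockSum f U w v := by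
  unfold blockSum
  rw [Finset.sum_comm]
  refine Finset.sum_le_sum fun B _ => ?_
  have h0 : ∀ w ∈ N, 0 ≤ if w ∈ B ∧ v ∈ B then f B else 0 := fun w _ => by
    split_ifs with h
    · exact hf B ⟨_, h.1⟩
    · rfl
  by_cases hv : v ∈ B
  · by_cases hd : Disjoint B N
    · simpa [restrictAt, meeting, hv, hd] using Finset.sum_nonneg h0
    · obtain ⟨w, hwB, hwN⟩ := Finset.not_disjoint_iff.mp hd
      refine le_trans ?_ (Finset.single_le_sum h0 hwN)
      simp [restrictAt, meeting, hv, hd, hwB]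
  · simp [restrictAt, hv]

theorem meeting_nonneg (hf : ∀ B : Finset V, B.Nonempty → 0 ≤ f B) (N : Finset V) :
    ∀ B : Finset V, B.Nonempty → 0 ≤ meeting N f B := fun B hB => by
  unfold meeting
  split_ifs
  · rfl
  · exact hf B hB

/-- Process the vertices of `N` one at a time. Each is either uncovered (factor 1) or lies in a
block, of total weight at most `β`; what remains avoids that vertex and need only meet the rest of
`N`. -/
theorem subsetExp_meeting_le (hf : ∀ B : Finset V, B.Nonempty → 0 ≤ f B) {β : ℝ} (hβ : 0 ≤ β)
    (N : Finset V) (U : Finset V) (hU : ∀ v, blockSum f U v v ≤ β) :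
    subsetExp (meeting N f) U ≤ (1 + β) ^ N.card := by
  induction N using Finset.induction_on generalizing U with
  | empty =>
    have : ∀ W : Finset V, setExp (meeting ∅ f) W = if W = ∅ then 1 else 0 := fun W => by
      rcases W.eq_empty_or_nonempty with rfl | ⟨v, hv⟩
      · simp
      · rw [setExp_expand _ hv, if_neg (Finset.ne_empty_of_mem hv)]
        exact Finset.sum_eq_zero fun B _ => by simp [restrictAt, meeting]
    simp [subsetExp, this]
  | insert v N hvN ih =>
    rw [Finset.card_insert_of_notMem hvN]
    by_cases hv : v ∈ U
    · have hsub : ∀ W ⊆ U, v ∉ W → subsetExp (meeting (insert v N) f) W ≤ (1 + β) ^ N.card :=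
        fun W hW hvW => by
          rw [subsetExp_congr fun B hB _ => meeting_insert_of_notMem N f fun h => hvW (hB h)]
          exact ih W fun w => (blockSum_mono hf hW w w).trans (hU w)
      rw [subsetExp_expand _ hv]
      have h1 := hsub (U.erase v) (Finset.erase_subset _ _) (Finset.notMem_erase v U)
      have h2 : conv (restrictAt v (meeting (insert v N) f)) (subsetExp (meeting (insert v N) f)) U ≤
          blockSum f U v v * (1 + β) ^ N.card := by
        unfold conv blockSum
        rw [Finset.sum_mul]
        refine Finset.sum_le_sum fun B _ => ?_
        by_cases hB : v ∈ B
        · have : restrictAt v (meeting (insert v N) f) B = f B := by simp [restrictAt, meeting, hB]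
          rw [this, if_pos ⟨hB, hB⟩]
          exact mul_le_mul_of_nonneg_left
            (hsub (U \ B) Finset.sdiff_subset (by simp [hB])) (hf B ⟨v, hB⟩)
        · simp [restrictAt, hB]
      have h3 : blockSum f U v v * (1 + β) ^ N.card ≤ β * (1 + β) ^ N.card :=
        mul_le_mul_of_nonneg_right (hU v) (by positivity)
      calc _ ≤ (1 + β) ^ N.card + β * (1 + β) ^ N.card := add_le_add h1 (h2.trans h3)
        _ = _ := by ring
    · rw [subsetExp_congr fun B hB _ => meeting_insert_of_notMem N f fun h => hv (hB h)]
      refine (ih U hU).trans (pow_le_pow_right₀ (by linarith) (Nat.le_succ _))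

end SubsetSum

/-! ### Weight of the blocks through given vertices -/

section BlockBounds

variable {V : Type*} [DecidableEq V] [Fintype V] (G : SimpleGraph V)

/-- The weight `y ^ |B| * t B` of the block `B`. -/
noncomputable def blockWeight (y : ℝ) (B : Finset V) : ℝ := y ^ B.card * blockCoeff G B

theorem blockWeight_nonneg {y : ℝ} (hy : 0 ≤ y) (B : Finset V) (hB : B.Nonempty) :
    0 ≤ blockWeight G y B :=
  mul_nonneg (by positivity) (Int.cast_nonneg (blockCoeff_nonneg G hB))

variable [DecidableRel G.Adj]

theorem blockWeight_insert (y : ℝ) {u : V} {B : Finset V} (hu : u ∉ B) :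
    blockWeight G y (insert u B) =
      y * setExp (meeting (G.neighborFinset u) (blockWeight G y)) B := by
  rw [blockWeight, blockCoeff_insert G hu, Finset.card_insert_of_notMem hu, pow_succ', mul_assoc]
  congr 1
  have := map_setExp (Int.castRingHom ℝ) (meeting (G.neighborFinset u) (blockCoeff G)) B
  simp only [eq_intCast] at this
  rw [this, ← setExp_pow_card_mul]
  congr 1
  funext C
  unfold meeting blockWeight
  split_ifs <;> simp

variable {Δ : ℕ} {y M : ℝ}

/-- Deleting `v` from its block leaves a family of blocks meeting at most `Δ` neighbours. By
induction this family weighs at most `(1 + y * M) ^ Δ ≤ M`, so `y * M` reproduces itself. -/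
theorem blockSum_self_le (hy : 0 ≤ y) (hM : 0 ≤ M) (hpow : (1 + y * M) ^ Δ ≤ M)
    (hdeg : ∀ v, G.degree v ≤ Δ) (U : Finset V) (v : V) :
    blockSum (blockWeight G y) U v v ≤ y * M := by
  induction hn : U.card using Nat.strong_induction_on generalizing U v with
  | _ n ih =>
  have hβ : 0 ≤ y * M := mul_nonneg hy hM
  by_cases hv : v ∈ U
  · have hv' := Finset.notMem_erase v U
    have : blockSum (blockWeight G y) U v v =
        y * subsetExp (meeting (G.neighborFinset v) (blockWeight G y)) (U.erase v) := by
      rw [blockSum, sum_powerset_split _ hv, subsetExp, Finset.mul_sum, Finset.sum_eq_zero, zero_add]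
      · refine Finset.sum_congr rfl fun B hB => ?_
        have hvB : v ∉ B := fun h => hv' (Finset.mem_powerset.mp hB h)
        simp [blockWeight_insert G y hvB]
      · intro B hB
        have hvB : v ∉ B := fun h => hv' (Finset.mem_powerset.mp hB h)
        simp [hvB]
    rw [this]
    refine mul_le_mul_of_nonneg_left (le_trans ?_ hpow) hy
    refine (subsetExp_meeting_le (blockWeight_nonneg G hy) hβ _ _ fun w =>
      ih _ (hn ▸ Finset.card_erase_lt_of_mem hv) _ w rfl).trans ?_
    exact pow_le_pow_right₀ (by linarith) (hdeg v)
  · rw [blockSum_of_notMem_left _ hv]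
    exact hβ

/-- After deleting `u`, one remaining block contains `w` and a neighbour of `u`; all the others
together contribute at most `M`. -/
theorem blockSum_insert_le (hy : 0 ≤ y) (hM : 0 ≤ M) (hpow : (1 + y * M) ^ Δ ≤ M)
    (hdeg : ∀ v, G.degree v ≤ Δ) {U : Finset V} {u w : V} (hu : u ∈ U) (hwu : w ≠ u) :
    blockSum (blockWeight G y) U u w ≤
      y * M * ∑ v ∈ G.neighborFinset u, blockSum (blockWeight G y) (U.erase u) v w := by
  have hβ : 0 ≤ y * M := mul_nonneg hy hM
  have hu' := Finset.notMem_erase u U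
  set N := G.neighborFinset u
  set f := blockWeight G y
  have hf := blockWeight_nonneg G hy
  have h1 : blockSum f U u w = y * conv (restrictAt w (meeting N f)) (subsetExp (meeting N f))
      (U.erase u) := by
    rw [blockSum, sum_powerset_split _ hu, ← sum_mem_setExp, Finset.mul_sum, Finset.sum_eq_zero,
      zero_add]
    · refine Finset.sum_congr rfl fun B hB => ?_
      have huB : u ∉ B := fun h => hu' (Finset.mem_powerset.mp hB h)
      simp [f, blockWeight_insert G y huB, hwu, N]
    · intro B hB
      have huB : u ∉ B := fun h => hu' (Finset.mem_powerset.mp hB h)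
      simp [huB]
  rw [h1, mul_assoc]
  refine mul_le_mul_of_nonneg_left ?_ hy
  calc _ ≤ ∑ B ∈ (U.erase u).powerset, restrictAt w (meeting N f) B * M := by
        refine Finset.sum_le_sum fun B _ => ?_
        by_cases hB : w ∈ B
        · refine mul_le_mul_of_nonneg_left ?_ ?_
          · refine (subsetExp_meeting_le hf hβ _ _ fun v =>
              blockSum_self_le G hy hM hpow hdeg _ v).trans (le_trans ?_ hpow)
            exact pow_le_pow_right₀ (by linarith) (hdeg u)
          · simpa [restrictAt, hB] using meeting_nonneg hf N B ⟨w, hB⟩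
        · simp [restrictAt, hB]
    _ = M * ∑ B ∈ (U.erase u).powerset, restrictAt w (meeting N f) B := by
        rw [← Finset.sum_mul, mul_comm]
    _ ≤ _ := mul_le_mul_of_nonneg_left (sum_meeting_le hf _ _ _) hM

/-- If every path inside `U` from `s` to `T` has length at least `m`, the blocks that meet `T`
and contain `s` have total weight at most `β L ^ m / (1 - L)`, for `β = y M` and `L = Δ β`. -/
theorem sum_blockSum_le (hy : 0 ≤ y) (hM : 0 ≤ M) (hpow : (1 + y * M) ^ Δ ≤ M)
    (hL : Δ * (y * M) < 1) (hdeg : ∀ v, G.degree v ≤ Δ) (U T : Finset V) (s : V) (m : ℕ)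
    (hpath : ∀ w ∈ T, ∀ p : G.Walk s w, p.IsPath → (∀ z ∈ p.support, z ∈ U) → m ≤ p.length) :
    ∑ w ∈ T, blockSum (blockWeight G y) U s w ≤
      y * M * (Δ * (y * M)) ^ m / (1 - Δ * (y * M)) := by
  have hβ : 0 ≤ y * M := mul_nonneg hy hM
  have hf := blockWeight_nonneg G hy
  have hL' : 0 < 1 - Δ * (y * M) := by linarith
  set f := blockWeight G y
  induction hn : U.card using Nat.strong_induction_on generalizing U T s m with
  | _ n ih =>
  by_cases hs : s ∈ U
  swap
  · rw [Finset.sum_eq_zero fun w _ => blockSum_of_notMem_left f hs]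
    positivity
  -- One move from `s` to a neighbour inside `U.erase s` gains a factor `L = Δ * (y * M)`.
  have step : ∀ (T' : Finset V) (m' : ℕ), s ∉ T' →
      (∀ v, G.Adj s v → ∀ w ∈ T', ∀ p : G.Walk v w, p.IsPath →
        (∀ z ∈ p.support, z ∈ U.erase s) → m' ≤ p.length) →
      ∑ w ∈ T', blockSum f U s w ≤
        y * M * (Δ * (y * M)) ^ (m' + 1) / (1 - Δ * (y * M)) := by
    intro T' m' hsT hT'
    calc _ ≤ ∑ w ∈ T', y * M * ∑ v ∈ G.neighborFinset s, blockSum f (U.erase s) v w :=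
          Finset.sum_le_sum fun w hw => blockSum_insert_le G hy hM hpow hdeg hs
            (fun h => hsT (h ▸ hw))
      _ = y * M * ∑ v ∈ G.neighborFinset s, ∑ w ∈ T', blockSum f (U.erase s) v w := by
          rw [← Finset.mul_sum, Finset.sum_comm]
      _ ≤ y * M * ∑ v ∈ G.neighborFinset s,
            y * M * (Δ * (y * M)) ^ m' / (1 - Δ * (y * M)) := by
          refine mul_le_mul_of_nonneg_left (Finset.sum_le_sum fun v hv => ?_) hβ
          exact ih _ (hn ▸ Finset.card_erase_lt_of_mem hs) _ _ _ _
            (hT' v (by simpa using hv)) rfl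
      _ = y * M * (G.degree s * (y * M * (Δ * (y * M)) ^ m' / (1 - Δ * (y * M)))) := by
          rw [Finset.sum_const, G.card_neighborFinset_eq_degree, nsmul_eq_mul]
      _ ≤ y * M * (Δ * (y * M * (Δ * (y * M)) ^ m' / (1 - Δ * (y * M)))) := by
          refine mul_le_mul_of_nonneg_left (mul_le_mul_of_nonneg_right ?_ (by positivity)) hβ
          exact_mod_cast hdeg s
      _ = _ := by ring
  cases m with
  -- The block may contain `s` itself as a target: `β + β L / (1 - L) = β / (1 - L)`.
  | zero =>
    have h1 := step (T.erase s) 0 (Finset.notMem_erase s T) (fun _ _ _ _ _ _ _ => Nat.zero_le _)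
    have h2 : ∑ w ∈ T, blockSum f U s w ≤
        blockSum f U s s + ∑ w ∈ T.erase s, blockSum f U s w := by
      by_cases hsT : s ∈ T
      · rw [Finset.add_sum_erase _ _ hsT]
      · rw [Finset.erase_eq_of_notMem hsT]
        linarith [blockSum_nonneg hf U s s]
    have h3 : blockSum f U s s ≤ y * M := blockSum_self_le G hy hM hpow hdeg U s
    calc _ ≤ y * M + y * M * (Δ * (y * M)) ^ (0 + 1) / (1 - Δ * (y * M)) := by linarith
      _ = _ := by
        rw [eq_div_iff hL'.ne', add_mul, div_mul_cancel₀ _ hL'.ne']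
        ring
  | succ m =>
    -- The trivial path at `s` would have length 0.
    have hsT : s ∉ T := fun hsT => by
      have := hpath s hsT SimpleGraph.Walk.nil SimpleGraph.Walk.IsPath.nil (by simpa using hs)
      simp at this
    refine step T m hsT fun v hv w hw p hp hpU => ?_
    have := hpath w hw (SimpleGraph.Walk.cons hv p)
      (hp.cons fun h => Finset.notMem_erase s U (hpU s h)) (by
        intro z hz
        rw [SimpleGraph.Walk.support_cons, List.mem_cons] at hz
        rcases hz with rfl | hz
        · exact hs
        · exact Finset.mem_of_mem_erase (hpU z hz))
    simpa using this

end BlockBounds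

/-! ### Adding a vertex to the partition function -/

section ZeroFree

variable {V : Type*} [DecidableEq V] (G : SimpleGraph V)

/-- The complex weight `x ^ (|B| - 1) * t B` of the block `B`. -/
noncomputable def polyWeight (x : ℂ) (B : Finset V) : ℂ := x ^ (B.card - 1) * blockCoeff G B

/-- The partition function of the blocks: the value at `x` of the generating function of the
broken-circuit-free sets of the subgraph of `G` induced by `U`. -/
noncomputable def partFun (x : ℂ) (U : Finset V) : ℂ := setExp (polyWeight G x) U

/-- The partition function in which each block that meets `N` carries an extra factor `1 + x`. -/
noncomputable def attachedPartFun (x : ℂ) (N U : Finset V) : ℂ :=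
  setExp (polyWeight G x + x • meeting N (polyWeight G x)) U

theorem mul_polyWeight (x : ℂ) {B : Finset V} (hB : B.Nonempty) :
    x * polyWeight G x B = x ^ B.card * blockCoeff G B := by
  rw [polyWeight, ← mul_assoc, ← pow_succ', Nat.sub_add_cancel hB.card_pos]

/-- The block of `u` without `u` is a family of blocks meeting the neighbourhood, each weighted `x ^
|C|`, which is `x` times its weight in `partFun`. Merging it with the other blocks gives each block
meeting the neighbourhood the factor `1 + x`. -/
theorem partFun_insert [Fintype V] [DecidableRel G.Adj] (x : ℂ) {u : V} {U : Finset V} (hu : u ∉ U) :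
    partFun G x (insert u U) = attachedPartFun G x (G.neighborFinset u) U := by
  rw [partFun, attachedPartFun, add_comm, setExp_add, setExp_expand _ (Finset.mem_insert_self u U)]
  unfold conv
  rw [Finset.sum_powerset_insert hu, Finset.sum_eq_zero, zero_add]
  · refine Finset.sum_congr rfl fun B hB => ?_
    have huB : u ∉ B := fun h => hu (Finset.mem_powerset.mp hB h)
    have h1 : insert u U \ insert u B = U \ B := by
      ext a
      simp only [Finset.mem_sdiff, Finset.mem_insert]
      constructor
      · tauto
      · rintro ⟨h, h'⟩
        exact ⟨Or.inr h, by rintro (rfl | h'') <;> tauto⟩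
    rw [h1]
    congr 1
    simp only [restrictAt, Finset.mem_insert_self, if_true, polyWeight]
    rw [blockCoeff_insert G huB, Finset.card_insert_of_notMem huB, Nat.add_sub_cancel]
    have := map_setExp (Int.castRingHom ℂ) (meeting (G.neighborFinset u) (blockCoeff G)) B
    simp only [eq_intCast] at this
    rw [this, ← setExp_pow_card_mul]
    refine setExp_congr fun C _ hC => ?_
    have := mul_polyWeight G x hC
    simp only [Pi.smul_apply, smul_eq_mul, meeting]
    split_ifs
    · simp
    · rw [this]
  · intro B hB
    have huB : u ∉ B := fun h => hu (Finset.mem_powerset.mp hB h)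
    simp [restrictAt, huB]

/-- The difference between the partition function whose vertices in `N` carry a factor `1 + x`
each and the one in which the blocks that meet `N` do. -/
noncomputable def attachDefect (x : ℂ) (N U : Finset V) : ℂ :=
  (1 + x) ^ N.card * partFun G x U - attachedPartFun G x N U

/-- Expand all partition functions along the block `B` of `v`. If `B` misses `N`, the new factor is
correctly placed and the old defect persists on `U \ B`; if `B` meets `N`, the factor for `v` is in
excess. -/
theorem attachDefect_insert (x : ℂ) {N U : Finset V} {v : V} (hvN : v ∉ N) (hvU : v ∈ U) :
    attachDefect G x (insert v N) U = attachDefect G x N U + ∑ B ∈ U.powerset,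
      if v ∈ B then x * polyWeight G x B *
        (if Disjoint B N then attachDefect G x N (U \ B)
          else (1 + x) ^ N.card * partFun G x (U \ B)) else 0 := by
  have e1 : partFun G x U = ∑ B ∈ U.powerset,
      if v ∈ B then polyWeight G x B * partFun G x (U \ B) else 0 := by
    rw [partFun, setExp_expand _ hvU]
    refine Finset.sum_congr rfl fun B _ => ?_
    by_cases hB : v ∈ B <;> simp [restrictAt, hB, partFun]
  have e2 : attachedPartFun G x N U = ∑ B ∈ U.powerset,
      if v ∈ B then (polyWeight G x B + x * meeting N (polyWeight G x) B) *
        attachedPartFun G x N (U \ B) else 0 := by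
    rw [attachedPartFun, setExp_expand _ hvU]
    refine Finset.sum_congr rfl fun B _ => ?_
    by_cases hB : v ∈ B <;> simp [restrictAt, hB, attachedPartFun]
  have e3 : attachedPartFun G x (insert v N) U = ∑ B ∈ U.powerset,
      if v ∈ B then (polyWeight G x B + x * polyWeight G x B) *
        attachedPartFun G x N (U \ B) else 0 := by
    rw [attachedPartFun, setExp_expand _ hvU]
    refine Finset.sum_congr rfl fun B _ => ?_
    by_cases hB : v ∈ B
    · have : setExp (polyWeight G x + x • meeting (insert v N) (polyWeight G x)) (U \ B) =
          attachedPartFun G x N (U \ B) := setExp_congr fun C hC _ => by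
        have hvC : v ∉ C := fun h => (Finset.mem_sdiff.mp (hC h)).2 hB
        simp [meeting_insert_of_notMem N _ hvC]
      rw [this]
      simp [restrictAt, hB, meeting]
    · simp [restrictAt, hB]
  have e4 : attachDefect G x (insert v N) U - attachDefect G x N U =
      x * (1 + x) ^ N.card * partFun G x U + attachedPartFun G x N U -
        attachedPartFun G x (insert v N) U := by
    rw [attachDefect, attachDefect, Finset.card_insert_of_notMem hvN]
    ring
  rw [← sub_eq_iff_eq_add', e4, e1, e2, e3, Finset.mul_sum, ← Finset.sum_add_distrib,
    ← Finset.sum_sub_distrib]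
  refine Finset.sum_congr rfl fun B _ => ?_
  by_cases hB : v ∈ B
  · by_cases hd : Disjoint B N
    · simp only [hB, hd, if_true, meeting, attachDefect]
      ring
    · simp only [hB, hd, if_true, if_false, meeting]
      ring
  · simp [hB]

/-- Induction on `N` by `attachDefect_insert`: the blocks of `v` missing `N` multiply the old bound
by at most `β`, and those meeting `N` contribute the new pairs `(w, v)`. The sum runs over ordered
pairs, hence the half. -/
theorem norm_attachDefect_le [Fintype V] {x : ℂ} {a y β : ℝ} (hy : 0 ≤ y) (ha : a < 1)
    (hx : ‖x‖ ≤ (1 - a) * y) (hxβ : ‖x‖ ≤ β)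
    (hS : ∀ (U : Finset V) v, blockSum (blockWeight G y) U v v ≤ β) (N U : Finset V) (hN : N ⊆ U)
    (hZ : ∀ W ⊆ U, ∀ B ⊆ W, (1 - a) ^ B.card * ‖partFun G x (W \ B)‖ ≤ ‖partFun G x W‖) :
    ‖attachDefect G x N U‖ ≤ (1 + β) ^ N.card *
      ((∑ p ∈ N.offDiag, blockSum (blockWeight G y) U p.1 p.2) / 2) * ‖partFun G x U‖ := by
  have hβ : 0 ≤ β := (norm_nonneg x).trans hxβ
  set f := blockWeight G y with hfdef
  have hf := blockWeight_nonneg G hy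
  induction N using Finset.induction_on generalizing U with
  | empty =>
    have : polyWeight G x + x • meeting ∅ (polyWeight G x) = polyWeight G x := by
      funext B
      simp [meeting]
    simp [attachDefect, attachedPartFun, partFun, this]
  | insert v N hvN ih =>
    obtain ⟨hvU, hNU⟩ := Finset.insert_subset_iff.mp hN
    set Q : Finset V → ℝ := fun W => (∑ p ∈ N.offDiag, blockSum f W p.1 p.2) / 2 with hQ
    have hQ0 : ∀ W, 0 ≤ Q W := fun W =>
      div_nonneg (Finset.sum_nonneg fun p _ => blockSum_nonneg hf _ _ _) zero_le_two
    have hQmono : ∀ W ⊆ U, Q W ≤ Q U := fun W hW =>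
      div_le_div_of_nonneg_right (Finset.sum_le_sum fun p _ => blockSum_mono hf hW _ _) zero_le_two
    set P := (1 + β) ^ N.card with hP
    have hP0 : 0 ≤ P := by positivity
    have hsum : (∑ p ∈ (insert v N).offDiag, blockSum f U p.1 p.2) / 2 =
        Q U + ∑ w ∈ N, blockSum f U w v := by
      rw [Finset.offDiag_insert hvN, Finset.sum_union, Finset.sum_union]
      · rw [Finset.singleton_product, Finset.product_singleton, Finset.sum_map, Finset.sum_map]
        simp [blockSum_comm f U v, hQ]
        ring
      · rw [Finset.disjoint_left]
        rintro ⟨p, q⟩ h1 h2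
        simp only [Finset.mem_offDiag, Finset.mem_product, Finset.mem_singleton] at h1 h2
        exact hvN (h2.1 ▸ h1.1)
      · rw [Finset.disjoint_left]
        rintro ⟨p, q⟩ h1 h2
        simp only [Finset.mem_union, Finset.mem_offDiag, Finset.mem_product,
          Finset.mem_singleton] at h1 h2
        rcases h1 with h1 | h1
        · exact hvN (h2.2 ▸ h1.2.1)
        · exact hvN (h2.2 ▸ h1.2)
    have hterm : ∀ B ∈ U.powerset, ‖if v ∈ B then x * polyWeight G x B *
        (if Disjoint B N then attachDefect G x N (U \ B)
          else (1 + x) ^ N.card * partFun G x (U \ B)) else 0‖ ≤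
        P * ‖partFun G x U‖ * ((if v ∈ B ∧ v ∈ B then f B else 0) * Q U +
          restrictAt v (meeting N f) B) := by
      intro B hB
      have hBU := Finset.mem_powerset.mp hB
      by_cases hvB : v ∈ B
      swap
      · simp [hvB, restrictAt]
      -- Passing from `U \ B` to `U` costs `(1 - a) ^ (-|B|)`; the bound `‖x‖ ≤ (1 - a) * y` pays
      -- exactly this and leaves the weight `y ^ |B|`.
      have hw : ∀ z : ℂ, ‖z‖ ≤ ‖partFun G x (U \ B)‖ →
          ‖x * polyWeight G x B * z‖ ≤ f B * ‖partFun G x U‖ := by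
        intro z hz
        rw [mul_polyWeight G x ⟨v, hvB⟩, norm_mul, norm_mul, norm_pow]
        have ht : ‖(blockCoeff G B : ℂ)‖ = blockCoeff G B := by
          rw [Complex.norm_intCast, abs_of_nonneg]
          exact_mod_cast blockCoeff_nonneg G ⟨v, hvB⟩
        have ht0 : (0 : ℝ) ≤ blockCoeff G B := by
          exact_mod_cast blockCoeff_nonneg G ⟨v, hvB⟩
        rw [ht]
        calc _ ≤ ((1 - a) * y) ^ B.card * blockCoeff G B * ‖partFun G x (U \ B)‖ := by gcongr
          _ = f B * ((1 - a) ^ B.card * ‖partFun G x (U \ B)‖) := by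
            rw [hfdef, blockWeight, mul_pow]; ring
          _ ≤ _ := mul_le_mul_of_nonneg_left (hZ U le_rfl B hBU) (hf B ⟨v, hvB⟩)
      have hscale : ∀ (z : ℂ) (c : ℝ), 0 ≤ c → ‖z‖ ≤ c * ‖partFun G x (U \ B)‖ →
          ‖x * polyWeight G x B * z‖ ≤ c * (f B * ‖partFun G x U‖) := by
        intro z c hc hz
        have h1 := hw ‖partFun G x (U \ B)‖ (by simp)
        calc ‖x * polyWeight G x B * z‖ = ‖x * polyWeight G x B‖ * ‖z‖ := norm_mul _ _
          _ ≤ ‖x * polyWeight G x B‖ * (c * ‖partFun G x (U \ B)‖) := by gcongr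
          _ = c * ‖x * polyWeight G x B * (‖partFun G x (U \ B)‖ : ℂ)‖ := by
            rw [norm_mul (x * _)]; simp; ring
          _ ≤ _ := mul_le_mul_of_nonneg_left h1 hc
      by_cases hd : Disjoint B N
      · simp only [hvB, hd, if_true, restrictAt, meeting, and_self, add_zero]
        have hsub : N ⊆ U \ B := fun w hw =>
          Finset.mem_sdiff.mpr ⟨hNU hw, Finset.disjoint_right.mp hd hw⟩
        have h1 := ih (U \ B) hsub fun W hW => hZ W (hW.trans Finset.sdiff_subset)
        refine (hscale _ (P * Q (U \ B)) (mul_nonneg hP0 (hQ0 _)) h1).trans ?_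
        have h2 := hQmono (U \ B) Finset.sdiff_subset
        have h3 : 0 ≤ f B := hf B ⟨v, hvB⟩
        calc _ ≤ P * Q U * (f B * ‖partFun G x U‖) := by gcongr
          _ = _ := by ring
      · simp only [hvB, hd, if_true, if_false, restrictAt, meeting, and_self]
        have h3 : 0 ≤ f B := hf B ⟨v, hvB⟩
        have h4 : ‖(1 + x) ^ N.card * partFun G x (U \ B)‖ ≤ P * ‖partFun G x (U \ B)‖ := by
          rw [norm_mul, norm_pow]
          have : ‖1 + x‖ ≤ 1 + β := (norm_add_le _ _).trans (by simpa using hxβ)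
          have := pow_le_pow_left₀ (norm_nonneg _) this N.card
          gcongr
        refine (hscale _ P hP0 h4).trans ?_
        have := mul_nonneg (mul_nonneg hP0 (norm_nonneg (partFun G x U))) (mul_nonneg h3 (hQ0 U))
        linarith
    rw [attachDefect_insert G x hvN hvU, hsum, Finset.card_insert_of_notMem hvN]
    have h1 := ih U hNU hZ
    have h2 := (norm_sum_le _ _).trans (Finset.sum_le_sum hterm)
    rw [← Finset.mul_sum, Finset.sum_add_distrib, ← Finset.sum_mul] at h2
    have h3 : ∑ B ∈ U.powerset, restrictAt v (meeting N f) B ≤ ∑ w ∈ N, blockSum f U w v :=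
      sum_meeting_le hf U N v
    have h4 : (∑ B ∈ U.powerset, if v ∈ B ∧ v ∈ B then f B else 0) ≤ β := hS U v
    have h5 : 0 ≤ ∑ w ∈ N, blockSum f U w v :=
      Finset.sum_nonneg fun w _ => blockSum_nonneg hf _ _ _
    have hQU := hQ0 U
    calc _ ≤ P * Q U * ‖partFun G x U‖ +
          P * ‖partFun G x U‖ * (β * Q U + ∑ w ∈ N, blockSum f U w v) := by
          refine (norm_add_le _ _).trans (add_le_add h1 (h2.trans ?_))
          gcongr
      _ ≤ P * Q U * ‖partFun G x U‖ + P * ‖partFun G x U‖ *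
          (β * Q U + (1 + β) * ∑ w ∈ N, blockSum f U w v) := by
          gcongr
          nlinarith
      _ = _ := by rw [pow_succ]; ring

end ZeroFree

/-! ### Girth and the zero-free disc -/

section ZeroFreeDisc

variable {V : Type*} (G : SimpleGraph V)

/-- Two neighbours of `u` are at distance at least `g - 2` in a graph of girth `g` without `u`. -/
theorem le_length_of_egirth {g : ℕ} (hgirth : (g : ℕ∞) ≤ G.egirth) {u v w : V} (huv : G.Adj u v)
    (huw : G.Adj u w) (hvw : v ≠ w) (p : G.Walk v w) (hp : p.IsPath) (hu : u ∉ p.support) :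
    g - 2 ≤ p.length := by
  have hc : (SimpleGraph.Walk.cons huw.symm (SimpleGraph.Walk.cons huv p)).IsCycle := by
    rw [SimpleGraph.Walk.cons_isCycle_iff]
    refine ⟨hp.cons hu, ?_⟩
    rw [SimpleGraph.Walk.edges_cons, List.mem_cons, not_or]
    refine ⟨fun h => ?_, fun h => hu (p.snd_mem_support_of_mem_edges h)⟩
    rcases Sym2.eq_iff.mp h with h | h
    · exact huw.ne h.1.symm
    · exact hvw h.1.symm
  have := hgirth.trans (SimpleGraph.egirth_le_length hc)
  rw [SimpleGraph.Walk.length_cons, SimpleGraph.Walk.length_cons, Nat.cast_le] at this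
  omega

variable [DecidableEq V] [Fintype V] [DecidableRel G.Adj]

theorem partFun_step {g Δ : ℕ} {a y M : ℝ} {x : ℂ} (hgirth : (g : ℕ∞) ≤ G.egirth) (hy : 0 ≤ y)
    (hM : 1 ≤ M) (hpow : (1 + y * M) ^ Δ ≤ M) (hL : Δ * (y * M) < 1)
    (hdeg : ∀ v, G.degree v ≤ Δ) (ha0 : 0 ≤ a) (ha : a < 1) (hx : ‖x‖ ≤ (1 - a) * y)
    (hbound : Real.exp (Δ * ((1 - a) * y)) - 1 +
      M * ((Δ * (y * M)) ^ (g - 2 + 1) / (1 - Δ * (y * M))) / 2 ≤ a)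
    {U : Finset V} {u : V} (hu : u ∉ U)
    (hZ : ∀ W ⊆ U, ∀ B ⊆ W, (1 - a) ^ B.card * ‖partFun G x (W \ B)‖ ≤ ‖partFun G x W‖) :
    (1 - a) * ‖partFun G x U‖ ≤ ‖partFun G x (insert u U)‖ := by
  have hM0 : 0 ≤ M := zero_le_one.trans hM
  have hβ : 0 ≤ y * M := mul_nonneg hy hM0
  have hf := blockWeight_nonneg G hy
  have hL' : 0 < 1 - Δ * (y * M) := by linarith
  have hxβ : ‖x‖ ≤ y * M := by
    refine hx.trans ?_
    have : (1 - a) * y ≤ 1 * y := mul_le_mul_of_nonneg_right (by linarith) hy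
    nlinarith
  set N := G.neighborFinset u ∩ U with hN
  have hcard : N.card ≤ Δ :=
    (Finset.card_le_card Finset.inter_subset_left).trans (hdeg u)
  -- Blocks inside `U` see only the neighbours in `U`, and the defect bound needs `N ⊆ U`.
  have hins : partFun G x (insert u U) = attachedPartFun G x N U := by
    rw [partFun_insert G x hu]
    refine setExp_congr fun B hB _ => ?_
    have : Disjoint B (G.neighborFinset u) ↔ Disjoint B N := by
      simp only [Finset.disjoint_left, hN, Finset.mem_inter]
      exact ⟨fun h b hb h' => h hb h'.1, fun h b hb h' => h hb ⟨h', hB hb⟩⟩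
    simp only [Pi.add_apply, Pi.smul_apply, meeting, this]
  have hD := norm_attachDefect_le G hy ha hx hxβ
    (blockSum_self_le G hy hM0 hpow hdeg) N U Finset.inter_subset_right hZ
  have hS : ∑ p ∈ N.offDiag, blockSum (blockWeight G y) U p.1 p.2 ≤
      (Δ * (y * M)) ^ (g - 2 + 1) / (1 - Δ * (y * M)) := by
    have h1 : ∑ p ∈ N.offDiag, blockSum (blockWeight G y) U p.1 p.2 =
        ∑ s ∈ N, ∑ w ∈ N.erase s, blockSum (blockWeight G y) U s w := by
      rw [Finset.sum_sigma']
      refine Finset.sum_bij' (fun p _ => ⟨p.1, p.2⟩) (fun p _ => (p.1, p.2)) ?_ ?_ ?_ ?_ ?_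
      · rintro ⟨p, q⟩ h
        simp only [Finset.mem_offDiag, Finset.mem_sigma, Finset.mem_erase] at h ⊢
        exact ⟨h.1, h.2.2.symm, h.2.1⟩
      · rintro ⟨p, q⟩ h
        simp only [Finset.mem_offDiag, Finset.mem_sigma, Finset.mem_erase] at h ⊢
        exact ⟨h.1, h.2.2, h.2.1.symm⟩
      all_goals intros; rfl
    rw [h1]
    calc _ ≤ ∑ s ∈ N, y * M * (Δ * (y * M)) ^ (g - 2) / (1 - Δ * (y * M)) := by
          refine Finset.sum_le_sum fun s hs => ?_
          -- Paths inside `U` avoid `u`, so the girth gives length at least `g - 2`. Summing over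
          -- `s` adds one more factor `Δ * (y * M)`, hence the exponent `g - 2 + 1`.
          refine sum_blockSum_le G hy hM0 hpow hL hdeg U (N.erase s) s (g - 2) ?_
          intro w hw p hp hpU
          simp only [hN, Finset.mem_erase, Finset.mem_inter, SimpleGraph.mem_neighborFinset]
            at hs hw
          exact le_length_of_egirth G hgirth hs.1 hw.2.1 hw.1.symm p hp fun h => hu (hpU u h)
      _ = N.card * (y * M * (Δ * (y * M)) ^ (g - 2) / (1 - Δ * (y * M))) := by
          rw [Finset.sum_const, nsmul_eq_mul]
      _ ≤ Δ * (y * M * (Δ * (y * M)) ^ (g - 2) / (1 - Δ * (y * M))) := by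
          have : (N.card : ℝ) ≤ Δ := by exact_mod_cast hcard
          gcongr
      _ = _ := by ring
  have hP : (1 + y * M) ^ N.card ≤ M :=
    (pow_le_pow_right₀ (by linarith) hcard).trans hpow
  have hD' : ‖attachDefect G x N U‖ ≤
      M * ((Δ * (y * M)) ^ (g - 2 + 1) / (1 - Δ * (y * M))) / 2 * ‖partFun G x U‖ := by
    refine hD.trans (mul_le_mul_of_nonneg_right ?_ (norm_nonneg _))
    rw [mul_div_assoc]
    refine mul_le_mul hP (div_le_div_of_nonneg_right hS zero_le_two) ?_ hM0
    exact div_nonneg (Finset.sum_nonneg fun p _ => blockSum_nonneg hf _ _ _) zero_le_two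
  have hpowx : ‖(1 + x) ^ N.card - 1‖ ≤ Real.exp (Δ * ((1 - a) * y)) - 1 := by
    have h1 : ∀ n : ℕ, ‖(1 + x) ^ n - 1‖ ≤ (1 + ‖x‖) ^ n - 1 := by
      intro n
      induction n with
      | zero => simp
      | succ n ih =>
        have e : (1 + x) ^ (n + 1) - 1 = (1 + x) * ((1 + x) ^ n - 1) + x := by ring
        rw [e]
        have h2 : ‖1 + x‖ ≤ 1 + ‖x‖ := (norm_add_le _ _).trans (by simp)
        calc _ ≤ ‖1 + x‖ * ‖(1 + x) ^ n - 1‖ + ‖x‖ := by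
              rw [← norm_mul]; exact norm_add_le _ _
          _ ≤ (1 + ‖x‖) * ((1 + ‖x‖) ^ n - 1) + ‖x‖ := by gcongr
          _ = _ := by ring
    refine (h1 _).trans (sub_le_sub_right ?_ 1)
    calc (1 + ‖x‖) ^ N.card ≤ (1 + ‖x‖) ^ Δ :=
          pow_le_pow_right₀ (by linarith [norm_nonneg x]) hcard
      _ ≤ Real.exp ‖x‖ ^ Δ := by
          refine pow_le_pow_left₀ (by positivity) ?_ _
          linarith [Real.add_one_le_exp ‖x‖]
      _ = Real.exp (Δ * ‖x‖) := (Real.exp_nat_mul _ _).symm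
      _ ≤ _ := Real.exp_le_exp.mpr (by gcongr)
  have hdiff : ‖partFun G x U - partFun G x (insert u U)‖ ≤ a * ‖partFun G x U‖ := by
    have e : partFun G x U - partFun G x (insert u U) =
        attachDefect G x N U - ((1 + x) ^ N.card - 1) * partFun G x U := by
      rw [hins, attachDefect]; ring
    rw [e]
    refine (norm_sub_le _ _).trans ?_
    rw [norm_mul]
    have := mul_le_mul_of_nonneg_right hpowx (norm_nonneg (partFun G x U))
    have := mul_le_mul_of_nonneg_right hbound (norm_nonneg (partFun G x U))
    linarith
  have := norm_sub_norm_le (partFun G x U) (partFun G x (insert u U))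
  linarith

/-- Strong induction on `U`, removing the vertices of `B` singly; the hypothesis of `partFun_step`
concerns only subsets of `U.erase u`. -/
theorem partFun_ratio {g Δ : ℕ} {a y M : ℝ} {x : ℂ} (hgirth : (g : ℕ∞) ≤ G.egirth) (hy : 0 ≤ y)
    (hM : 1 ≤ M) (hpow : (1 + y * M) ^ Δ ≤ M) (hL : Δ * (y * M) < 1)
    (hdeg : ∀ v, G.degree v ≤ Δ) (ha0 : 0 ≤ a) (ha : a < 1) (hx : ‖x‖ ≤ (1 - a) * y)
    (hbound : Real.exp (Δ * ((1 - a) * y)) - 1 +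
      M * ((Δ * (y * M)) ^ (g - 2 + 1) / (1 - Δ * (y * M))) / 2 ≤ a)
    (U B : Finset V) (hB : B ⊆ U) :
    (1 - a) ^ B.card * ‖partFun G x (U \ B)‖ ≤ ‖partFun G x U‖ := by
  induction hn : U.card using Nat.strong_induction_on generalizing U B with
  | _ n ih =>
  rcases B.eq_empty_or_nonempty with rfl | ⟨u, hu⟩
  · simp
  · have huU := hB hu
    have hlt := hn ▸ Finset.card_erase_lt_of_mem huU
    have h1 := ih _ hlt (U.erase u) (B.erase u) (Finset.erase_subset_erase u hB) rfl
    have h2 := partFun_step G hgirth hy hM hpow hL hdeg ha0 ha hx hbound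
      (Finset.notMem_erase u U) fun W hW C hC =>
        ih _ ((Finset.card_le_card hW).trans_lt hlt) W C hC rfl
    rw [Finset.insert_erase huU] at h2
    have h3 : U.erase u \ B.erase u = U \ B := by
      ext z
      simp only [Finset.mem_sdiff, Finset.mem_erase]
      constructor
      · tauto
      · rintro ⟨h, h'⟩
        exact ⟨⟨fun hz => h' (hz ▸ hu), h⟩, fun hz => h' hz.2⟩
    rw [h3] at h1
    have h4 : (1 - a) ^ B.card = (1 - a) * (1 - a) ^ (B.erase u).card := by
      rw [← pow_succ', Finset.card_erase_add_one hu]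
    rw [h4, mul_assoc]
    exact (mul_le_mul_of_nonneg_left h1 (by linarith)).trans h2

theorem partFun_ne_zero {g Δ : ℕ} {a b : ℝ} (hg : 3 ≤ g) (ha : a ∈ Set.Ico (0 : ℝ) 1)
    (hb : b ∈ Set.Ico (1 : ℝ) (Real.exp 1)) (hf : fFun g a b ≤ a) (hgirth : (g : ℕ∞) ≤ G.egirth)
    (hΔ : 1 ≤ Δ) (hdeg : G.maxDegree ≤ Δ) {x : ℂ} (hx : ‖x‖ ≤ hFun a b / Δ) (U : Finset V) :
    partFun G x U ≠ 0 := by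
  have hb0 : 0 < b := zero_lt_one.trans_le hb.1
  have hlog : 0 ≤ Real.log b := Real.log_nonneg hb.1
  have hlog1 : Real.log b < 1 := (Real.log_lt_iff_lt_exp hb0).mpr hb.2
  have hΔ0 : (0 : ℝ) < Δ := by exact_mod_cast hΔ
  -- With `M = b` this makes `Δ * (y * M) = log b`, so `(1 + y * M) ^ Δ ≤ exp (log b) = M`.
  set y := Real.log b / (b * Δ) with hy
  have hy0 : 0 ≤ y := by positivity
  have hyb : y * b = Real.log b / Δ := by rw [hy]; field_simp
  have hL : Δ * (y * b) = Real.log b := by rw [hyb]; field_simp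
  have hpow : (1 + y * b) ^ Δ ≤ b := by
    calc (1 + y * b) ^ Δ ≤ Real.exp (y * b) ^ Δ := by
          refine pow_le_pow_left₀ (by positivity) ?_ _
          linarith [Real.add_one_le_exp (y * b)]
      _ = b := by rw [← Real.exp_nat_mul, hL, Real.exp_log hb0]
  have hh : hFun a b / Δ = (1 - a) * y := by
    rw [hFun, hy]; field_simp
  have hexp : Δ * ((1 - a) * y) = (1 - a) * Real.log b / b := by
    rw [hy]; field_simp
  have hratio := partFun_ratio G (a := a) (M := b) hgirth hy0 hb.1 hpow (hL ▸ hlog1)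
    (fun v => (G.degree_le_maxDegree v).trans hdeg) ha.1 ha.2 (hh ▸ hx) (by
      rw [hL, hexp, show g - 2 + 1 = g - 1 by omega]
      refine le_trans (le_of_eq ?_) hf
      -- Removing all of `U` leaves the value 1 at `∅`, so the norm at `U` is at least `(1 - a) ^
      -- |U| > 0`.
      rw [fFun, mul_comm (2 : ℝ), ← div_div, mul_div_assoc b (Real.log b ^ (g - 1))]) U U le_rfl
  rw [Finset.sdiff_self] at hratio
  intro h0
  rw [h0] at hratio
  have : 0 < (1 - a) ^ U.card := pow_pos (by linarith [ha.2]) _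
  simp [partFun] at hratio
  linarith

end ZeroFreeDisc

/-! ### Counting components -/

section Components

variable {V : Type*}

theorem eq_of_reachable {α : Type*} {H : SimpleGraph V} (c : V → α)
    (hc : ∀ a b, H.Adj a b → c a = c b) {a b : V} (h : H.Reachable a b) : c a = c b := by
  obtain ⟨p⟩ := h
  induction p with
  | nil => rfl
  | cons hadj _ ih => exact (hc _ _ hadj).trans ih

/-- The functions on the connected components are the functions that are constant along edges. -/
def componentFunEquiv (α : Type*) (H : SimpleGraph V) :
    (H.ConnectedComponent → α) ≃ {c : V → α // ∀ a b, H.Adj a b → c a = c b} where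
  toFun f := ⟨fun v => f (H.connectedComponentMk v), fun a b h =>
    congrArg f (SimpleGraph.ConnectedComponent.sound h.reachable)⟩
  invFun c := SimpleGraph.ConnectedComponent.lift c.1 fun _ _ p _ => eq_of_reachable c.1 c.2 ⟨p⟩
  left_inv f := by
    funext C
    induction C using SimpleGraph.ConnectedComponent.ind with
    | _ v => rfl
  right_inv c := rfl

theorem pow_card_connectedComponent [Finite V] (H : SimpleGraph V) (q : ℕ) :
    q ^ Nat.card H.ConnectedComponent =
      Nat.card {c : V → Fin q // ∀ a b, H.Adj a b → c a = c b} := by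
  rw [← Nat.card_congr (componentFunEquiv (Fin q) H), Nat.card_fun, Nat.card_fin]

theorem card_connectedComponent_congr {H H' : SimpleGraph V}
    (h : ∀ a b, H.Reachable a b ↔ H'.Reachable a b) :
    Nat.card H.ConnectedComponent = Nat.card H'.ConnectedComponent :=
  Nat.card_congr (Quot.congrRight h)

theorem numComponents_insert_of_reachable {A : Set (Sym2 V)} {u v : V}
    (h : (SimpleGraph.fromEdgeSet A).Reachable u v) :
    numComponents (insert s(u, v) A) = numComponents A := by
  refine card_connectedComponent_congr fun a b => ⟨fun hab => ?_, fun hab =>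
    hab.mono (SimpleGraph.fromEdgeSet_mono (Set.subset_insert _ _))⟩
  refine SimpleGraph.ConnectedComponent.exact
    (eq_of_reachable (SimpleGraph.fromEdgeSet A).connectedComponentMk (fun a b hadj => ?_) hab)
  refine SimpleGraph.ConnectedComponent.sound ?_
  obtain ⟨hmem, hne⟩ := (SimpleGraph.fromEdgeSet_adj _).mp hadj
  rcases hmem with hmem | hmem
  · rcases Sym2.eq_iff.mp hmem with ⟨rfl, rfl⟩ | ⟨rfl, rfl⟩
    · exact h
    · exact h.symm
  · exact ((SimpleGraph.fromEdgeSet_adj _).mpr ⟨hmem, hne⟩ : (SimpleGraph.fromEdgeSet A).Adj a b).reachable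

theorem numComponents_insert_of_not_reachable [Finite V] {A : Set (Sym2 V)} {u v : V}
    (h : ¬ (SimpleGraph.fromEdgeSet A).Reachable u v) :
    numComponents (insert s(u, v) A) + 1 = numComponents A := by
  classical
  set H := SimpleGraph.fromEdgeSet A with hH
  set H' := SimpleGraph.fromEdgeSet (insert s(u, v) A) with hH'
  have hle : H ≤ H' := SimpleGraph.fromEdgeSet_mono (Set.subset_insert _ _)
  have hne : H.connectedComponentMk u ≠ H.connectedComponentMk v := fun h' =>
    h (SimpleGraph.ConnectedComponent.exact h')
  have huv : u ≠ v := fun h' => h (h' ▸ SimpleGraph.Reachable.refl u)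
  -- The new edge merges the component of `v` into that of `u`; the component of `v` is the one
  -- lost.
  let c : V → H.ConnectedComponent := fun w =>
    if H.connectedComponentMk w = H.connectedComponentMk v then H.connectedComponentMk u
    else H.connectedComponentMk w
  have hcu : c u = H.connectedComponentMk u := if_neg hne
  have hcv : c v = H.connectedComponentMk u := if_pos rfl
  have hc : ∀ a b, H'.Adj a b → c a = c b := by
    intro a b hadj
    obtain ⟨hmem, hne'⟩ := (SimpleGraph.fromEdgeSet_adj _).mp hadj
    rcases hmem with hmem | hmem
    · rcases Sym2.eq_iff.mp hmem with ⟨rfl, rfl⟩ | ⟨rfl, rfl⟩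
      · rw [hcu, hcv]
      · rw [hcu, hcv]
    · have hab : H.Adj a b := (SimpleGraph.fromEdgeSet_adj _).mpr ⟨hmem, hne'⟩
      simp only [c, SimpleGraph.ConnectedComponent.sound hab.reachable]
  let e : H'.ConnectedComponent ≃ {C : H.ConnectedComponent // C ≠ H.connectedComponentMk v} :=
    { toFun := SimpleGraph.ConnectedComponent.lift
        (fun w => ⟨c w, by
          by_cases hw : H.connectedComponentMk w = H.connectedComponentMk v
          · rw [show c w = H.connectedComponentMk u from if_pos hw]; exact hne
          · rw [show c w = H.connectedComponentMk w from if_neg hw]; exact hw⟩)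
        fun a b p _ => Subtype.ext (eq_of_reachable c hc ⟨p⟩)
      invFun := fun C => C.1.map (SimpleGraph.Hom.ofLE hle)
      left_inv := by
        intro C
        induction C using SimpleGraph.ConnectedComponent.ind with
        | _ w =>
        change (c w).map (SimpleGraph.Hom.ofLE hle) = H'.connectedComponentMk w
        by_cases hw : H.connectedComponentMk w = H.connectedComponentMk v
        · rw [show c w = H.connectedComponentMk u from if_pos hw]
          refine SimpleGraph.ConnectedComponent.sound ?_
          have h1 : H'.Adj u v :=
            (SimpleGraph.fromEdgeSet_adj _).mpr ⟨Set.mem_insert _ _, huv⟩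
          exact h1.reachable.trans ((SimpleGraph.ConnectedComponent.exact hw).mono hle).symm
        · rw [show c w = H.connectedComponentMk w from if_neg hw]
          rfl
      right_inv := by
        rintro ⟨C, hC⟩
        induction C using SimpleGraph.ConnectedComponent.ind with
        | _ w => exact Subtype.ext (if_neg hC) }
  change Nat.card H'.ConnectedComponent + 1 = Nat.card H.ConnectedComponent
  rw [Nat.card_congr e]
  have := Fintype.ofFinite H.ConnectedComponent
  have hpos : 0 < Fintype.card H.ConnectedComponent :=
    Fintype.card_pos_iff.mpr ⟨H.connectedComponentMk v⟩
  rw [Nat.card_eq_fintype_card, Nat.card_eq_fintype_card, Fintype.card_subtype_compl,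
    Fintype.card_subtype_eq]
  omega

theorem numComponents_add_card_of_isAcyclic [Fintype V] (A : Finset (Sym2 V))
    (hd : ∀ e ∈ A, ¬ e.IsDiag) (hA : (SimpleGraph.fromEdgeSet (A : Set (Sym2 V))).IsAcyclic) :
    numComponents (A : Set (Sym2 V)) + A.card = Fintype.card V := by
  classical
  induction A using Finset.induction_on with
  | empty =>
    have : (fun a b => (SimpleGraph.fromEdgeSet ((∅ : Finset (Sym2 V)) : Set (Sym2 V))).Reachable a b)
        = Eq := by
      funext a b
      simp
    rw [numComponents, Finset.card_empty, add_zero, ← Nat.card_eq_fintype_card]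
    refine (Nat.card_congr (Equiv.ofBijective
      (SimpleGraph.connectedComponentMk _) ⟨fun a b hab => ?_, Quot.mk_surjective⟩)).symm
    exact (congrFun (congrFun this a) b).mp (SimpleGraph.ConnectedComponent.exact hab)
  | insert e A he ih =>
    have hle : SimpleGraph.fromEdgeSet (A : Set (Sym2 V)) ≤
        SimpleGraph.fromEdgeSet ((insert e A : Finset (Sym2 V)) : Set (Sym2 V)) :=
      SimpleGraph.fromEdgeSet_mono (by simp)
    have ih := ih (fun e' h' => hd e' (Finset.mem_insert_of_mem h')) (hA.anti hle)
    induction e using Sym2.ind with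
    | _ u v =>
    have hbr := SimpleGraph.isAcyclic_iff_forall_isBridge.mp hA (e := s(u, v)) (by
      rw [SimpleGraph.edgeSet_fromEdgeSet]
      exact ⟨by simp, hd _ (Finset.mem_insert_self _ _)⟩)
    rw [SimpleGraph.isBridge_iff] at hbr
    have hnr : ¬ (SimpleGraph.fromEdgeSet (A : Set (Sym2 V))).Reachable u v := fun h =>
      hbr (h.mono fun a b hab => by
        rw [SimpleGraph.deleteEdges_adj]
        refine ⟨hle hab, fun h' => he ?_⟩
        rw [Set.mem_singleton_iff] at h'
        exact h' ▸ ((SimpleGraph.fromEdgeSet_adj _).mp hab).1)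
    have := numComponents_insert_of_not_reachable hnr
    rw [Finset.coe_insert, Finset.card_insert_of_notMem he]
    omega

end Components

/-! ### Broken circuits -/

section Whitney

variable {V : Type*} (G : SimpleGraph V)

theorem exists_least_of_linearOrder {α : Type*} (ord : LinearOrder α) {S : Set α} (hf : S.Finite)
    (h : S.Nonempty) : ∃ m ∈ S, ∀ m' ∈ S, ord.le m m' :=
  letI := ord
  Set.exists_min_image S id hf h

theorem exists_greatest_of_linearOrder {α : Type*} (ord : LinearOrder α) {S : Set α}
    (hf : S.Finite) (h : S.Nonempty) : ∃ m ∈ S, ∀ m' ∈ S, ord.le m' m :=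
  letI := ord
  Set.exists_max_image S id hf h

/-- `A` contains a broken circuit from which the edge `m` was removed. -/
def ContainsBroken (ord : LinearOrder G.edgeSet) (A : Set (Sym2 V)) (m : G.edgeSet) : Prop :=
  ∃ (v : V) (c : G.Walk v v), c.IsCycle ∧ (m : Sym2 V) ∈ c.edgeSet ∧
    (∀ e : G.edgeSet, (e : Sym2 V) ∈ c.edgeSet → ord.le e m) ∧ c.edgeSet \ {(m : Sym2 V)} ⊆ A

variable {G} {ord : LinearOrder G.edgeSet}

theorem isBCF_iff {A : Set (Sym2 V)} :
    IsBCF G ord A ↔ A ⊆ G.edgeSet ∧ ∀ m, ¬ ContainsBroken G ord A m := by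
  unfold IsBCF IsBrokenCircuit ContainsBroken
  refine and_congr_right fun _ => ⟨fun h m ⟨v, c, h1, h2, h3, h4⟩ => ?_,
    fun h B ⟨v, c, m, h1, h2, h3, h4⟩ hB => ?_⟩
  · exact h _ ⟨v, c, m, h1, h2, h3, rfl⟩ h4
  · exact h m ⟨v, c, h1, h2, h3, h4 ▸ hB⟩

/-- A cycle with largest edge `m' ≤ m` can contain `m` only if `m = m'`, and then `m` is the edge
removed. So the presence of `m` in `A` is irrelevant. -/
theorem ContainsBroken.congr_of_le {A A' : Set (Sym2 V)} {m m' : G.edgeSet} (hm : ord.le m' m)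
    (hA : ∀ e, e ≠ (m : Sym2 V) → (e ∈ A → e ∈ A')) (h : ContainsBroken G ord A m') :
    ContainsBroken G ord A' m' := by
  obtain ⟨v, c, h1, h2, h3, h4⟩ := h
  refine ⟨v, c, h1, h2, h3, fun e he => hA e (fun hem => ?_) (h4 he)⟩
  have h5 : m = m' := ord.le_antisymm _ _ (h3 m (hem ▸ he.1)) hm
  exact he.2 (by rw [hem, h5]; rfl)

theorem ContainsBroken.reachable {A : Set (Sym2 V)} {m : G.edgeSet} (h : ContainsBroken G ord A m)
    {a b : V} (hab : (m : Sym2 V) = s(a, b)) : (SimpleGraph.fromEdgeSet A).Reachable a b := by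
  obtain ⟨v, c, h1, h2, h3, h4⟩ := h
  set H := SimpleGraph.fromEdgeSet c.edgeSet with hH
  have hcH : ∀ e ∈ c.edges, e ∈ H.edgeSet := fun e he => by
    rw [SimpleGraph.edgeSet_fromEdgeSet]
    exact ⟨SimpleGraph.Walk.mem_edgeSet.mpr he,
      G.not_isDiag_of_mem_edgeSet (c.edges_subset_edgeSet he)⟩
  have hnb : ¬ H.IsBridge s(a, b) := fun hb => by
    have := hb.notMem_edges_of_isCycle (h1.transfer hcH)
    rw [SimpleGraph.Walk.edges_transfer, ← hab] at this
    exact this (SimpleGraph.Walk.mem_edgeSet.mp h2)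
  rw [SimpleGraph.isBridge_iff, not_not] at hnb
  refine hnb.mono fun x y hxy => ?_
  rw [SimpleGraph.deleteEdges_adj, SimpleGraph.fromEdgeSet_adj] at hxy
  exact (SimpleGraph.fromEdgeSet_adj _).mpr ⟨h4 ⟨hxy.1.1, hab ▸ hxy.2⟩, hxy.1.2⟩

/-- A cycle inside `F` would bring its own broken circuit. -/
theorem IsBCF.isAcyclic {F : Set (Sym2 V)} (h : IsBCF G ord F) :
    (SimpleGraph.fromEdgeSet F).IsAcyclic := by
  intro v c hc
  have hle : SimpleGraph.fromEdgeSet F ≤ G := by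
    rw [← G.fromEdgeSet_edgeSet]
    exact SimpleGraph.fromEdgeSet_mono h.1
  have hcG := hc.mapLe hle
  have hedges : ∀ e, e ∈ (c.mapLe hle).edgeSet → e ∈ F := fun e he => by
    rw [SimpleGraph.Walk.mem_edgeSet, SimpleGraph.Walk.edges_mapLe_eq_edges] at he
    have := c.edges_subset_edgeSet he
    rw [SimpleGraph.edgeSet_fromEdgeSet] at this
    exact this.1
  have hne : {e : G.edgeSet | (e : Sym2 V) ∈ (c.mapLe hle).edgeSet}.Nonempty := by
    obtain ⟨e, he⟩ := List.exists_mem_of_ne_nil _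
      (SimpleGraph.Walk.edges_eq_nil.not.mpr hcG.not_nil)
    exact ⟨⟨e, (c.mapLe hle).edges_subset_edgeSet he⟩, SimpleGraph.Walk.mem_edgeSet.mpr he⟩
  have hfin : {e : G.edgeSet | (e : Sym2 V) ∈ (c.mapLe hle).edgeSet}.Finite :=
    Set.Finite.preimage Subtype.val_injective.injOn
      ((c.mapLe hle).edges.finite_toSet.subset fun e he => SimpleGraph.Walk.mem_edgeSet.mp he)
  obtain ⟨m, hm, hmax⟩ := exists_greatest_of_linearOrder ord hfin hne
  exact h.2 _ ⟨v, _, m, hcG, hm, hmax, rfl⟩ fun e he => hedges e he.1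

theorem isBCF_empty : IsBCF G ord ∅ := by
  refine isBCF_iff.mpr ⟨Set.empty_subset _, fun m h => ?_⟩
  have := m.2
  induction hm : (m : Sym2 V) using Sym2.ind with
  | _ a b =>
  rw [hm, SimpleGraph.mem_edgeSet] at this
  have h1 := h.reachable hm
  rw [SimpleGraph.fromEdgeSet_empty, SimpleGraph.reachable_bot] at h1
  exact this.ne h1

open Classical in
/-- **Whitney's broken-circuit theorem.** -/
theorem chromaticPoly_eq_sum_isBCF [Fintype V] [DecidableRel G.Adj] (ord : LinearOrder G.edgeSet) :
    chromaticPoly G =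
      ∑ F ∈ G.edgeFinset.powerset.filter (fun F : Finset (Sym2 V) => IsBCF G ord (F : Set (Sym2 V))),
        (-1) ^ F.card * X ^ (Fintype.card V - F.card) := by
  rw [chromaticPoly, ← Finset.sum_filter_add_sum_filter_not G.edgeFinset.powerset
    (fun F : Finset (Sym2 V) => IsBCF G ord (F : Set (Sym2 V)))]
  have hzero : ∑ A ∈ G.edgeFinset.powerset.filter
      (fun F : Finset (Sym2 V) => ¬ IsBCF G ord (F : Set (Sym2 V))),
      ((-1) ^ A.card * X ^ numComponents (A : Set (Sym2 V)) : ℂ[X]) = 0 := by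
    have hex : ∀ A ∈ G.edgeFinset.powerset.filter
        (fun F : Finset (Sym2 V) => ¬ IsBCF G ord (F : Set (Sym2 V))),
        ∃ m, ContainsBroken G ord (A : Set (Sym2 V)) m ∧
          ∀ m', ContainsBroken G ord (A : Set (Sym2 V)) m' → ord.le m m' := by
      intro A hA
      rw [Finset.mem_filter, isBCF_iff, Finset.mem_powerset] at hA
      have hsub : (A : Set (Sym2 V)) ⊆ G.edgeSet := fun e he =>
        SimpleGraph.mem_edgeFinset.mp (hA.1 he)
      have := hA.2
      push Not at this
      exact exists_least_of_linearOrder ord (Set.toFinite _) (this hsub)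
    choose m hm hmin using hex
    -- Sign-reversing involution: toggle the least edge `m` completing a broken circuit of `A`. The
    -- endpoints of `m` are already joined by the rest of its cycle, so the number of components is
    -- unchanged, and by `congr_of_le` the least such edge stays the same.
    let tog : Finset (Sym2 V) → Sym2 V → Finset (Sym2 V) := fun A e =>
      if e ∈ A then A.erase e else insert e A
    have htog : ∀ A e e', e' ≠ e → (e' ∈ tog A e ↔ e' ∈ A) := by
      intro A e e' hne
      by_cases h : e ∈ A <;> simp [tog, h, hne]
    have htog2 : ∀ A e, tog (tog A e) e = A := by
      intro A e
      by_cases h : e ∈ A <;> simp [tog, h]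
    have hbr : ∀ A hA, ContainsBroken G ord (tog A (m A hA) : Set (Sym2 V)) (m A hA) :=
      fun A hA => (hm A hA).congr_of_le (ord.le_refl _) fun e he h =>
        (htog A _ e he).mpr h
    have hmem : ∀ A hA, tog A (m A hA) ∈ G.edgeFinset.powerset.filter
        (fun F : Finset (Sym2 V) => ¬ IsBCF G ord (F : Set (Sym2 V))) := by
      intro A hA
      have hA' := hA
      rw [Finset.mem_filter, Finset.mem_powerset] at hA' ⊢
      refine ⟨fun e he => ?_, fun h => (isBCF_iff.mp h).2 _ (hbr A hA)⟩
      by_cases hem : e = m A hA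
      · exact hem ▸ SimpleGraph.mem_edgeFinset.mpr (m A hA).2
      · exact hA'.1 ((htog A _ e hem).mp he)
    have hmm : ∀ A hA, m (tog A (m A hA)) (hmem A hA) = m A hA := by
      intro A hA
      have h1 := hmin _ (hmem A hA) _ (hbr A hA)
      refine ord.le_antisymm _ _ h1 (hmin A hA _ ?_)
      exact (hm _ (hmem A hA)).congr_of_le h1 fun e he h => (htog A _ e he).mp h
    have hκ : ∀ (A : Finset (Sym2 V)) (e : G.edgeSet),
        ContainsBroken G ord (A : Set (Sym2 V)) e →
        numComponents ((insert (e : Sym2 V) A : Finset (Sym2 V)) : Set (Sym2 V)) =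
          numComponents (A : Set (Sym2 V)) := by
      intro A e hA
      rw [Finset.coe_insert]
      induction he : (e : Sym2 V) using Sym2.ind with
      | _ a b => exact numComponents_insert_of_reachable (hA.reachable he)
    refine Finset.sum_involution (fun A hA => tog A (m A hA)) ?_ ?_ hmem ?_
    · intro A hA
      by_cases h : (m A hA : Sym2 V) ∈ A
      · have e1 : tog A (m A hA) = A.erase (m A hA) := if_pos h
        have h1 := hκ (A.erase (m A hA)) (m A hA) (e1 ▸ hbr A hA)
        rw [Finset.insert_erase h] at h1
        rw [e1, h1, ← Finset.card_erase_add_one h]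
        ring
      · have e1 : tog A (m A hA) = insert (m A hA : Sym2 V) A := if_neg h
        rw [e1, hκ A _ (hm A hA), Finset.card_insert_of_notMem h]
        ring
    · intro A hA _ heq
      by_cases h : (m A hA : Sym2 V) ∈ A
      · have e1 : tog A (m A hA) = A.erase (m A hA) := if_pos h
        rw [e1] at heq
        exact Finset.notMem_erase _ _ ((Finset.ext_iff.mp heq _).mpr h)
      · have e1 : tog A (m A hA) = insert (m A hA : Sym2 V) A := if_neg h
        rw [e1] at heq
        exact h ((Finset.ext_iff.mp heq _).mp (Finset.mem_insert_self _ _))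
    · intro A hA
      simp only [hmm]
      exact htog2 A _
  rw [hzero, add_zero]
  refine Finset.sum_congr rfl fun F hF => ?_
  rw [Finset.mem_filter, Finset.mem_powerset] at hF
  have := numComponents_add_card_of_isAcyclic F
    (fun e he => G.not_isDiag_of_mem_edgeSet (SimpleGraph.mem_edgeFinset.mp (hF.1 he)))
    hF.2.isAcyclic
  rw [← this, Nat.add_sub_cancel]

end Whitney

theorem eval_zero_bcfPoly {V : Type*} [Fintype V] (G : SimpleGraph V) [DecidableRel G.Adj]
    (ord : LinearOrder G.edgeSet) :
    (bcfPoly G ord).eval 0 = 1 := by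
  classical
  rw [bcfPoly, Polynomial.eval_finsetSum, Finset.sum_eq_single ∅]
  · simp
  · intro F _ hF
    simp [hF]
  · intro h
    refine (h (Finset.mem_filter.mpr ⟨Finset.empty_mem_powerset _, ?_⟩)).elim
    rw [Finset.coe_empty]
    exact isBCF_empty

/-! ### Colorings and the exponential formula -/

section Colorings

variable {V : Type*} [DecidableEq V] [Fintype V] (G : SimpleGraph V)

open Classical in
/-- The proper colorings of `G[U]` with the colors below `q`, extended by `0` outside `U`. -/
noncomputable def properColorings (q : ℕ) (U : Finset V) : Finset (V → ℕ) :=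
  (Fintype.piFinset fun v => if v ∈ U then Finset.range q else {0}).filter
    fun c => ∀ a ∈ U, ∀ b ∈ U, G.Adj a b → c a ≠ c b

theorem mem_properColorings {q : ℕ} {U : Finset V} {c : V → ℕ} :
    c ∈ properColorings G q U ↔ (∀ v ∈ U, c v < q) ∧ (∀ v ∉ U, c v = 0) ∧
      ∀ a ∈ U, ∀ b ∈ U, G.Adj a b → c a ≠ c b := by
  classical
  rw [properColorings, Finset.mem_filter, Fintype.mem_piFinset, ← and_assoc]
  refine and_congr_left fun _ => ⟨fun h => ⟨fun v hv => ?_, fun v hv => ?_⟩, fun h v => ?_⟩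
  · simpa [hv] using h v
  · simpa [hv] using h v
  · by_cases hv : v ∈ U
    · simpa [hv] using h.1 v hv
    · simpa [hv] using h.2 v hv

/-- Sort the colorings by the class `W` of the last color `q`. Fixing the value 0 outside the
colored set makes erasing this class a bijection. -/
theorem card_properColorings_succ (q : ℕ) (U : Finset V) :
    ((properColorings G (q + 1) U).card : ℤ) =
      ∑ W ∈ U.powerset, indepInd G W * (properColorings G q (U \ W)).card := by
  rw [Finset.card_eq_sum_card_fiberwise (t := U.powerset)
    (f := fun c : V → ℕ => U.filter fun v => c v = q)
    (fun c _ => Finset.mem_coe.mpr (Finset.mem_powerset.mpr (Finset.filter_subset _ _)))]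
  push_cast
  refine Finset.sum_congr rfl fun W hW => ?_
  have hWU := Finset.mem_powerset.mp hW
  have key : ∀ c : V → ℕ, U.filter (fun v => c v = q) = W → ∀ v ∈ U, (c v = q ↔ v ∈ W) := by
    rintro c rfl v hv
    simp [hv]
  unfold indepInd
  split_ifs with hI
  · rw [one_mul]
    congr 1
    refine Finset.card_bij' (fun c _ v => if v ∈ W then 0 else c v)
      (fun c _ v => if v ∈ W then q else c v) ?_ ?_ ?_ ?_
    · intro c hc
      rw [Finset.mem_filter, mem_properColorings] at hc
      obtain ⟨⟨h1, h2, h3⟩, h4⟩ := hc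
      have h5 := key c h4
      rw [mem_properColorings]
      refine ⟨fun v hv => ?_, fun v hv => ?_, fun a ha b hb hab => ?_⟩
      · obtain ⟨hvU, hvW⟩ := Finset.mem_sdiff.mp hv
        have h6 := h1 v hvU
        have h7 : c v ≠ q := fun h => hvW ((h5 v hvU).mp h)
        simp only [hvW, if_false]
        omega
      · by_cases hvW : v ∈ W
        · simp [hvW]
        · simp only [hvW, if_false]
          exact h2 v fun hvU => hv (Finset.mem_sdiff.mpr ⟨hvU, hvW⟩)
      · obtain ⟨haU, haW⟩ := Finset.mem_sdiff.mp ha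
        obtain ⟨hbU, hbW⟩ := Finset.mem_sdiff.mp hb
        simpa [haW, hbW] using h3 a haU b hbU hab
    · intro c hc
      rw [mem_properColorings] at hc
      obtain ⟨h1, h2, h3⟩ := hc
      have h1' : ∀ v ∈ U, v ∉ W → c v < q := fun v hv hvW =>
        h1 v (Finset.mem_sdiff.mpr ⟨hv, hvW⟩)
      rw [Finset.mem_filter, mem_properColorings]
      refine ⟨⟨fun v hv => ?_, fun v hv => ?_, fun a ha b hb hab => ?_⟩, ?_⟩
      · by_cases hvW : v ∈ W
        · simp [hvW]
        · simp only [hvW, if_false]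
          have := h1' v hv hvW
          omega
      · have hvW : v ∉ W := fun h => hv (hWU h)
        simp only [hvW, if_false]
        exact h2 v fun h => hv (Finset.mem_sdiff.mp h).1
      · by_cases haW : a ∈ W <;> by_cases hbW : b ∈ W
        · exact (hI haW hbW hab.ne hab).elim
        · simpa [haW, hbW] using (h1' b hb hbW).ne'
        · simpa [haW, hbW] using (h1' a ha haW).ne
        · simpa [haW, hbW] using h3 a (Finset.mem_sdiff.mpr ⟨ha, haW⟩) b
            (Finset.mem_sdiff.mpr ⟨hb, hbW⟩) hab
      · ext v
        rw [Finset.mem_filter]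
        by_cases hvW : v ∈ W
        · simp [hvW, hWU hvW]
        · simp only [hvW, if_false, iff_false, not_and]
          exact fun hv => (h1' v hv hvW).ne
    · intro c hc
      rw [Finset.mem_filter] at hc
      funext v
      by_cases hvW : v ∈ W
      · simp [hvW, (key c hc.2 v (hWU hvW)).mpr hvW]
      · simp [hvW]
    · intro c hc
      rw [mem_properColorings] at hc
      funext v
      by_cases hvW : v ∈ W
      · simp [hvW, hc.2.1 v (by simp [hvW])]
      · simp [hvW]
  · rw [zero_mul, Nat.cast_eq_zero, Finset.card_eq_zero, Finset.filter_eq_empty_iff]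
    intro c hc h4
    have h5 := key c h4
    rw [mem_properColorings] at hc
    refine hI fun a ha b hb _ hab => hc.2.2 a (hWU ha) b (hWU hb) hab ?_
    rw [(h5 a (hWU ha)).mpr ha, (h5 b (hWU hb)).mpr hb]

theorem card_properColorings (q : ℕ) (U : Finset V) :
    ((properColorings G q U).card : ℤ) = setExp (q • setLog (indepInd G)) U := by
  induction q generalizing U with
  | zero =>
    rcases U.eq_empty_or_nonempty with rfl | ⟨v, hv⟩
    · rw [setExp_empty, Nat.cast_eq_one, Finset.card_eq_one]
      refine ⟨0, Finset.ext fun c => ?_⟩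
      rw [mem_properColorings, Finset.mem_singleton, funext_iff]
      simp
    · rw [setExp_expand _ hv]
      have h0 : properColorings G 0 U = ∅ := Finset.eq_empty_of_forall_notMem fun c hc => by
        rw [mem_properColorings] at hc
        exact absurd (hc.1 v hv) (Nat.not_lt_zero _)
      simp [h0, conv, restrictAt]
  | succ q ih =>
    rw [card_properColorings_succ, succ_nsmul', setExp_add, setExp_setLog (indepInd_empty G)]
    exact Finset.sum_congr rfl fun W _ => by rw [ih]

-- Inclusion–exclusion: `q ^ κ(A)` counts the colorings constant along the edges of `A`, and the
-- alternating sum over sets `A` of monochromatic edges vanishes unless there are none.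
open Classical in
theorem sum_neg_one_pow_mul_pow_numComponents [DecidableRel G.Adj] (q : ℕ) :
    ∑ A ∈ G.edgeFinset.powerset, (-1 : ℤ) ^ A.card * (q : ℤ) ^ numComponents (A : Set (Sym2 V)) =
      (properColorings G q Finset.univ).card := by
  let mono : (V → Fin q) → Finset (Sym2 V) := fun c => G.edgeFinset.filter fun e => (e.map c).IsDiag
  have hmono : ∀ c a b, s(a, b) ∈ mono c ↔ G.Adj a b ∧ c a = c b := by
    intro c a b
    simp [mono]
  have h1 : ∀ A ∈ G.edgeFinset.powerset, ((q : ℤ) ^ numComponents (A : Set (Sym2 V))) =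
      ∑ c : V → Fin q, if A ⊆ mono c then 1 else 0 := by
    intro A hA
    have hA := Finset.mem_powerset.mp hA
    rw [numComponents, ← Nat.cast_pow, pow_card_connectedComponent, Nat.card_eq_fintype_card,
      Fintype.card_subtype, Finset.sum_boole]
    congr 3
    funext c
    refine propext ⟨fun h e he => ?_, fun h a b hab => ?_⟩
    · induction e using Sym2.ind with
      | _ a b =>
      have hadj : G.Adj a b := by simpa using hA he
      exact (hmono c a b).mpr ⟨hadj, h a b ((SimpleGraph.fromEdgeSet_adj _).mpr ⟨he, hadj.ne⟩)⟩
    · exact ((hmono c a b).mp (h ((SimpleGraph.fromEdgeSet_adj _).mp hab).1)).2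
  have h2 : ∀ c : V → Fin q, ∑ A ∈ G.edgeFinset.powerset,
      ((-1 : ℤ) ^ A.card * if A ⊆ mono c then 1 else 0) =
        if (∀ a b, G.Adj a b → c a ≠ c b) then 1 else 0 := by
    intro c
    simp only [mul_ite, mul_one, mul_zero]
    rw [← Finset.sum_filter]
    have : G.edgeFinset.powerset.filter (fun A => A ⊆ mono c) = (mono c).powerset := by
      ext A
      simp only [Finset.mem_filter, Finset.mem_powerset]
      exact ⟨fun h => h.2, fun h => ⟨h.trans (Finset.filter_subset _ _), h⟩⟩
    rw [this, Finset.sum_powerset_neg_one_pow_card]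
    congr 1
    refine propext ⟨fun h a b hab heq => ?_, fun h => Finset.eq_empty_of_forall_notMem fun e he => ?_⟩
    · have := (hmono c a b).mpr ⟨hab, heq⟩
      simp [h] at this
    · induction e using Sym2.ind with
      | _ a b =>
      have := (hmono c a b).mp he
      exact h a b this.1 this.2
  rw [Finset.sum_congr rfl fun A hA => by rw [h1 A hA, Finset.mul_sum], Finset.sum_comm,
    Finset.sum_congr rfl fun c _ => h2 c, Finset.sum_boole]
  congr 1
  refine Finset.card_bij (fun c _ v => (c v : ℕ)) ?_ ?_ ?_
  · intro c hc
    rw [Finset.mem_filter] at hc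
    rw [mem_properColorings]
    exact ⟨fun v _ => (c v).2, fun v hv => (hv (Finset.mem_univ v)).elim,
      fun a _ b _ hab h => hc.2 a b hab (Fin.ext h)⟩
  · intro c _ c' _ h
    funext v
    exact Fin.ext (congrFun h v)
  · intro c hc
    rw [mem_properColorings] at hc
    refine ⟨fun v => ⟨c v, hc.1 v (Finset.mem_univ v)⟩, ?_, rfl⟩
    rw [Finset.mem_filter]
    exact ⟨Finset.mem_univ _, fun a b hab h => hc.2.2 a (Finset.mem_univ a) b (Finset.mem_univ b)
      hab (congrArg Fin.val h)⟩

/-- The chromatic polynomial is the exponential of a linear function of its argument. -/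
theorem eval_chromaticPoly [DecidableRel G.Adj] (z : ℂ) :
    (chromaticPoly G).eval z =
      setExp (fun B => z * ((setLog (indepInd G) B : ℤ) : ℂ)) Finset.univ := by
  have hpoly : chromaticPoly G =
      setExp (fun B => X * C ((setLog (indepInd G) B : ℤ) : ℂ)) (Finset.univ : Finset V) := by
    -- Both sides are polynomials that agree at every natural number.
    refine Polynomial.eq_of_infinite_eval_eq _ _ (Set.Infinite.mono ?_
      (Set.infinite_range_of_injective (Nat.cast_injective (R := ℂ))))
    rintro _ ⟨q, rfl⟩
    have h1 := sum_neg_one_pow_mul_pow_numComponents G q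
    rw [card_properColorings] at h1
    have h2 := congrArg (Int.castRingHom ℂ) h1
    rw [map_setExp] at h2
    have h3 := map_setExp (Polynomial.evalRingHom (q : ℂ))
      (fun B => X * C ((setLog (indepInd G) B : ℤ) : ℂ)) (Finset.univ : Finset V)
    simp only [Polynomial.coe_evalRingHom] at h3
    rw [Set.mem_ofPred_eq, h3, chromaticPoly, Polynomial.eval_finsetSum]
    simp at h2 ⊢
    exact h2
  have h3 := map_setExp (Polynomial.evalRingHom z)
    (fun B => X * C ((setLog (indepInd G) B : ℤ) : ℂ)) (Finset.univ : Finset V)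
  simp only [Polynomial.coe_evalRingHom] at h3
  rw [hpoly, h3]
  simp

theorem partFun_univ [DecidableRel G.Adj] {x : ℂ} (hx : x ≠ 0) :
    partFun G x Finset.univ = (-x) ^ Fintype.card V * (chromaticPoly G).eval (-x⁻¹) := by
  rw [eval_chromaticPoly, ← Finset.card_univ, ← setExp_pow_card_mul, partFun]
  refine setExp_congr fun B _ hB => ?_
  rw [polyWeight, blockCoeff]
  obtain ⟨k, hk⟩ : ∃ k, B.card = k + 1 := ⟨B.card - 1, by have := hB.card_pos; omega⟩
  rw [hk, Nat.add_sub_cancel]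
  push_cast
  have h1 : (-1 : ℂ) ^ (k + 1 + 1) = (-1) ^ k := by ring
  have h2 : (-x) ^ (k + 1) = (-1) ^ k * x ^ k * (-x) := by
    rw [pow_succ, neg_pow x k]
  rw [h1, h2]
  field_simp

theorem eval_bcfPoly [DecidableRel G.Adj] (ord : LinearOrder G.edgeSet) {x : ℂ} (hx : x ≠ 0) :
    (bcfPoly G ord).eval x = partFun G x Finset.univ := by
  classical
  rw [partFun_univ G hx, chromaticPoly_eq_sum_isBCF ord, bcfPoly, Polynomial.eval_finsetSum,
    Polynomial.eval_finsetSum, Finset.mul_sum]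
  refine Finset.sum_congr rfl fun F hF => ?_
  rw [Finset.mem_filter, Finset.mem_powerset] at hF
  have hcard := numComponents_add_card_of_isAcyclic F
    (fun e he => G.not_isDiag_of_mem_edgeSet (SimpleGraph.mem_edgeFinset.mp (hF.1 he)))
    hF.2.isAcyclic
  obtain ⟨k, hk⟩ : ∃ k, Fintype.card V = F.card + k :=
    ⟨numComponents (F : Set (Sym2 V)), by omega⟩
  have h1 : (-x) ^ k * (-x⁻¹) ^ k = 1 := by
    rw [← mul_pow, neg_mul_neg, mul_inv_cancel₀ hx, one_pow]
  have h2 : (-x) ^ F.card * (-1) ^ F.card = x ^ F.card := by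
    rw [← mul_pow]
    simp
  simp only [eval_pow, eval_X, eval_mul, eval_neg, eval_one]
  rw [hk, Nat.add_sub_cancel_left, pow_add, ← h2]
  linear_combination -((-x) ^ F.card * (-1) ^ F.card) * h1

end Colorings

end ChromaticZeros

theorem theorem3p1 (g : ℕ) (hg : 3 ≤ g) (a b : ℝ) (ha : a ∈ Set.Ico (0 : ℝ) 1)
    (hb : b ∈ Set.Ico (1 : ℝ) (Real.exp 1)) (hf : ChromaticZeros.fFun g a b ≤ a)
    {V : Type*} [Fintype V] (G : SimpleGraph V) [DecidableRel G.Adj]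
    (hgirth : (g : ℕ∞) ≤ G.egirth) (Δ : ℕ) (hΔ : 1 ≤ Δ) (hdeg : G.maxDegree ≤ Δ) :
    (∀ (ord : LinearOrder G.edgeSet) (x : ℂ), ‖x‖ ≤ ChromaticZeros.hFun a b / Δ →
      (ChromaticZeros.bcfPoly G ord).eval x ≠ 0) ∧
    (0 < ChromaticZeros.hFun a b → ∀ x : ℂ, Δ / ChromaticZeros.hFun a b ≤ ‖x‖ →
      (ChromaticZeros.chromaticPoly G).eval x ≠ 0) := by
  classical
  refine ⟨fun ord x hx => ?_, fun hh x hx => ?_⟩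
  -- The passage through `χ_G(-1/x)` excludes 0, where the empty set alone contributes.
  · by_cases h0 : x = 0
    · rw [h0, ChromaticZeros.eval_zero_bcfPoly]
      exact one_ne_zero
    · rw [ChromaticZeros.eval_bcfPoly G ord h0]
      exact ChromaticZeros.partFun_ne_zero G hg ha hb hf hgirth hΔ hdeg hx _
  · have hΔ0 : (0 : ℝ) < Δ := by exact_mod_cast hΔ
    have hpos : 0 < ‖x‖ := (div_pos hΔ0 hh).trans_le hx
    have h0 : x ≠ 0 := norm_pos_iff.mp hpos
    have hx' : ‖-x⁻¹‖ ≤ ChromaticZeros.hFun a b / Δ := by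
      rw [norm_neg, norm_inv, ← inv_div]
      exact inv_anti₀ (div_pos hΔ0 hh) hx
    have h1 := ChromaticZeros.partFun_ne_zero G hg ha hb hf hgirth hΔ hdeg hx' Finset.univ
    rw [ChromaticZeros.partFun_univ G (neg_ne_zero.mpr (inv_ne_zero h0))] at h1
    have h2 : -(-x⁻¹)⁻¹ = x := by rw [inv_neg, neg_neg, inv_inv]
    rw [h2] at h1
    exact right_ne_zero_of_mul h1
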